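/- For $\lambda>0$ let $M_\lambda=([0,\lambda]\times[0,1])/\!\sim$, where $(0,y)\sim(\lambda,1-y)$ for $y\in[0,1]$, be the flat Möbius band obtained from a $1\times\lambda$ rectangle by gluing its sides of length $1$ with a flip, with its flat metric and its structure of a smooth surface with boundary, so that the universal covering map $\mathbb R\times[0,1]\to M_\lambda$ is a local isometry. A smooth embedded paper Möbius band of aspect ratio $\lambda$ is an injective map $I:M_\lambda\to\mathbb R^3$ which is infinitely differentiable (at boundary points this means that, in local coordinates, $I$ extends to a $C^\infty$ map on a neighborhood of the point) and isometric, in the sense that it preserves the arc length of paths. Theorem. Let $\lambda>0$. If there is a smooth embedded paper Möbius band of aspect ratio $\lambda$, then $\lambda>\sqrt3$. -/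

import Mathlib

open scoped ContDiff

namespace PaperMoebius

/-- The Euclidean plane. -/
abbrev Plane : Type := EuclideanSpace ℝ (Fin 2)

/-- Euclidean three-space. -/
abbrev Space : Type := EuclideanSpace ℝ (Fin 3)

/-- The rectangle `[0, l] × [0, 1]`. -/
def Rect (l : ℝ) : Set Plane :=
  {p | p 0 ∈ Set.Icc 0 l ∧ p 1 ∈ Set.Icc (0 : ℝ) 1}

/-- `p = (0, y)` and `q = (l, 1 - y)` for some `y`. -/
def Glued (l : ℝ) (p q : Plane) : Prop :=
  p 0 = 0 ∧ q 0 = l ∧ q 1 = 1 - p 1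

theorem plane_ext {p q : Plane} (h₀ : p 0 = q 0) (h₁ : p 1 = q 1) : p = q := by
  ext i
  fin_cases i
  · exact h₀
  · exact h₁

/-- The equivalence relation on the rectangle that identifies `(0, y)` with `(l, 1 - y)`. -/
def gluing (l : ℝ) : Setoid (Rect l) where
  r p q := p = q ∨ Glued l p q ∨ Glued l q p
  iseqv :=
    { refl := fun _ => Or.inl rfl
      symm := by
        rintro p q (h | h | h)
        · exact Or.inl h.symm
        · exact Or.inr (Or.inr h)
        · exact Or.inr (Or.inl h)
      trans := by
        rintro p q r (rfl | h) (rfl | h')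
        · exact Or.inl rfl
        · exact Or.inr h'
        · exact Or.inr h
        · refine Or.inl (Subtype.ext (plane_ext ?_ ?_)) <;>
            rcases h with ⟨h1, h2, h3⟩ | ⟨h1, h2, h3⟩ <;>
            rcases h' with ⟨h4, h5, h6⟩ | ⟨h4, h5, h6⟩ <;> linarith }

/-- The flat Moebius band `M_l = ([0, l] × [0, 1]) / ∼`, where `(0, y) ∼ (l, 1 - y)`. -/
def FlatMoebius (l : ℝ) : Type := Quotient (gluing l)

/-- The infinite strip `ℝ × [0, 1]`, the universal cover of the flat Moebius band. -/
def Strip : Set Plane := {p | p 1 ∈ Set.Icc (0 : ℝ) 1}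

/-- The point of the rectangle that represents the point `p` of the strip:
if `p = (k l + x, y)` with `k` an integer and `0 ≤ x < l`, it is `(x, y)` for even `k` and
`(x, 1 - y)` for odd `k`. -/
noncomputable def foldPoint {l : ℝ} (hl : 0 < l) (p : Strip) : Rect l :=
  ⟨!₂[toIcoMod hl 0 (p.1 0), if Even (toIcoDiv hl 0 (p.1 0)) then p.1 1 else 1 - p.1 1], by
    have h := toIcoMod_mem_Ico hl 0 (p.1 0)
    have h0 : 0 ≤ p.1 1 := p.2.1
    have h1 : p.1 1 ≤ 1 := p.2.2
    rw [zero_add] at h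
    refine ⟨⟨h.1, h.2.le⟩, ?_⟩
    change (if Even (toIcoDiv hl 0 (p.1 0)) then p.1 1 else 1 - p.1 1) ∈ Set.Icc (0 : ℝ) 1
    split_ifs
    · exact ⟨h0, h1⟩
    · exact ⟨by linarith, by linarith⟩⟩

/-- The universal covering map `ℝ × [0, 1] → M_l`. The smooth structure (with boundary) and the
flat metric of `M_l` are the ones for which this map is a local isometry. -/
noncomputable def cover {l : ℝ} (hl : 0 < l) (p : Strip) : FlatMoebius l :=
  Quotient.mk (gluing l) (foldPoint hl p)

/-- `I : M_l → ℝ³` is `C^∞`, including at the boundary: in the coordinates given by the covering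
map, `I` extends to a `C^∞` map on an open neighborhood of each point. -/
def IsSmooth {l : ℝ} (hl : 0 < l) (I : FlatMoebius l → Space) : Prop :=
  ∀ p : Strip, ∃ U : Set Plane, IsOpen U ∧ (p : Plane) ∈ U ∧
    ∃ g : Plane → Space, ContDiffOn ℝ ∞ g U ∧
      ∀ q : Strip, (q : Plane) ∈ U → g q = I (cover hl q)

/-- `I : M_l → ℝ³` preserves the arc length of every path. Each path in `M_l` is the image under
the covering map of a path `γ` in the strip, and it has the same length as `γ`. Arc length is the
total variation with respect to the Euclidean distance. -/
def PreservesArcLength {l : ℝ} (hl : 0 < l) (I : FlatMoebius l → Space) : Prop :=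
  ∀ γ : ℝ → Strip, Continuous γ → ∀ a b : ℝ,
    eVariationOn (fun t => I (cover hl (γ t))) (Set.Icc a b) =
      eVariationOn (fun t => (γ t : Plane)) (Set.Icc a b)

/-- `I` is a smooth paper Moebius band of aspect ratio `l`. -/
structure IsSmoothPaperMoebius {l : ℝ} (hl : 0 < l) (I : FlatMoebius l → Space) : Prop where
  smooth : IsSmooth hl I
  isometric : PreservesArcLength hl I

/-- `I` is a smooth embedded paper Moebius band of aspect ratio `l`. -/
structure IsSmoothEmbeddedPaperMoebius {l : ℝ} (hl : 0 < l) (I : FlatMoebius l → Space) : Prop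
    extends IsSmoothPaperMoebius hl I where
  injective : Function.Injective I

end PaperMoebius

/-! The band carries a continuous family of straight chords. Two of them are coplanar and
perpendicular, and comparing lengths along the boundary forces λ > √3.

Chords. Unrolled to the strip, the map is a flat surface, so its second fundamental form is
degenerate. The Codazzi equations keep a kernel direction constant along its own line up to the
boundary of the strip (`sff_along_ruling`), and this line maps to a straight segment. Rulings do not
cross, so their slopes are a 2-Lipschitz function of the midpoint. Any 2-Lipschitz extension κ over
the planar pieces still gives straight chords (`sff_chord_eq_zero`). It need not be equivariant: κ(a
+ l) = -κ(a) at a single a is enough.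

Perpendicular pair. Over one period the chord returns to itself reversed. With directions u and
midpoints m, the function ⟨u s, u t⟩ + i⟨m s - m t, u s × u t⟩ is positive on the diagonal of the
triangle a ≤ s ≤ t ≤ a + l and changes sign between the other two sides, so it has a zero
(`exists_perpendicular_coplanar`).

Lengths. The two lines meet at a point o. By embeddedness o is not interior to both chords, so some
chord lies on one side of o and its far end has height at least 1 over the line of the other chord.
If the other chord has slope k, its squared length is 1 + k². Its ends have distances to the far end
with sum A, A² > 5 + k², and to the near end with sum B, B² ≥ 1 + k². Boundary arcs give A ≤ l ± k
and B ≤ l ∓ k; adding squares, 6 + 2k² < 2l² + 2k². -/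

namespace PaperMoebius

/-! ### The unrolled map: first-order isometry and deck transformations. -/

/-- The interior of the strip. -/
def OpenStrip : Set Plane := {p | p 1 ∈ Set.Ioo (0 : ℝ) 1}

theorem isOpen_openStrip : IsOpen OpenStrip :=
  isOpen_Ioo.preimage (by fun_prop : Continuous fun p : Plane => p 1)

theorem openStrip_subset : OpenStrip ⊆ Strip := fun _ hp => ⟨hp.1.le, hp.2.le⟩

open Classical in
/-- The map `I`, precomposed with the universal covering map of the strip and extended by zero
to the plane. -/
noncomputable def unroll {l : ℝ} (hl : 0 < l) (I : FlatMoebius l → Space) (p : Plane) : Space :=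
  if h : p ∈ Strip then I (cover hl ⟨p, h⟩) else 0

variable {l : ℝ} {hl : 0 < l} {I : FlatMoebius l → Space}

theorem unroll_of_mem {p : Plane} (h : p ∈ Strip) : unroll hl I p = I (cover hl ⟨p, h⟩) :=
  dif_pos h

theorem IsSmooth.contDiffOn_unroll (h : IsSmooth hl I) :
    ContDiffOn ℝ ∞ (unroll hl I) OpenStrip := by
  intro p hp
  obtain ⟨U, hU, hpU, g, hg, hgI⟩ := h ⟨p, openStrip_subset hp⟩
  refine ContDiffAt.contDiffWithinAt ?_
  refine (hg.contDiffAt (hU.mem_nhds hpU)).congr_of_eventuallyEq ?_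
  filter_upwards [hU.mem_nhds hpU, isOpen_openStrip.mem_nhds hp] with q hq hq'
  rw [unroll_of_mem (openStrip_subset hq')]
  exact (hgI ⟨q, openStrip_subset hq'⟩ hq).symm

theorem PreservesArcLength.eVariationOn_unroll (h : PreservesArcLength hl I) {p v : Plane}
    {a b : ℝ} (hab : a ≤ b) (hmem : ∀ t ∈ Set.Icc a b, p + t • v ∈ Strip) :
    eVariationOn (fun t : ℝ => unroll hl I (p + t • v)) (Set.Icc a b) =
      eVariationOn (fun t : ℝ => p + t • v) (Set.Icc a b) := by
  -- Clamping the parameter by `Set.projIcc` makes the segment a path defined on all of ℝ.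
  have key := h (fun t => ⟨p + (Set.projIcc a b hab t : ℝ) • v, hmem _ (Set.projIcc a b hab t).2⟩)
    (by fun_prop) a b
  have hproj : ∀ t ∈ Set.Icc a b, (Set.projIcc a b hab t : ℝ) = t := fun t ht => by
    rw [Set.projIcc_of_mem hab ht]
  rw [eVariationOn.eq_of_eqOn (f' := fun t : ℝ => unroll hl I (p + t • v)),
    eVariationOn.eq_of_eqOn (f := fun t => p + (Set.projIcc a b hab t : ℝ) • v)
      (f' := fun t : ℝ => p + t • v)] at key
  · exact key
  · intro t ht
    simp only [hproj t ht]
  · intro t ht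
    have := unroll_of_mem (hl := hl) (I := I) (hmem t ht)
    simp only [this]
    congr 3
    rw [hproj t ht]

theorem eVariationOn_id_Icc_le {a b : ℝ} (hab : a ≤ b) :
    eVariationOn (fun t : ℝ => t) (Set.Icc a b) ≤ ENNReal.ofReal (b - a) := by
  have := ((monotone_id (α := ℝ)).monotoneOn (Set.Icc a b)).eVariationOn_eq
    (Set.left_mem_Icc.2 hab) (Set.right_mem_Icc.2 hab)
  rw [Set.inter_self] at this
  exact this.le

theorem eVariationOn_line_le (p v : Plane) {a b : ℝ} (hab : a ≤ b) :
    eVariationOn (fun t : ℝ => p + t • v) (Set.Icc a b) ≤ ENNReal.ofReal (‖v‖ * (b - a)) := by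
  have hL : LipschitzOnWith ‖v‖₊ (fun t : ℝ => p + t • v) Set.univ := by
    refine LipschitzOnWith.of_dist_le_mul fun s _ t _ => ?_
    rw [dist_add_left, dist_eq_norm, ← sub_smul, norm_smul, mul_comm, coe_nnnorm, Real.dist_eq,
      Real.norm_eq_abs]
  have h1 := hL.comp_eVariationOn_le (f := fun t : ℝ => p + t • v) (g := fun t : ℝ => t)
    (s := Set.Icc a b) (fun _ _ => Set.mem_univ _)
  have h2 := eVariationOn_id_Icc_le hab
  refine h1.trans ?_
  rw [ENNReal.ofReal_mul (norm_nonneg _), ofReal_norm]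
  exact mul_le_mul_right h2 _

theorem add_smul_mem_strip {p v : Plane} (hp : p ∈ Strip) (hq : p + v ∈ Strip) {t : ℝ}
    (ht : t ∈ Set.Icc (0 : ℝ) 1) : p + t • v ∈ Strip := by
  obtain ⟨h0, h1⟩ := hp
  obtain ⟨h2, h3⟩ := hq
  obtain ⟨h4, h5⟩ := ht
  simp only [PiLp.add_apply] at h2 h3
  constructor <;> simp only [PiLp.add_apply, PiLp.smul_apply, smul_eq_mul] <;> nlinarith

/-- The segment between two points stays in the strip, and the length of its image bounds the
distance of the image points. -/
theorem PreservesArcLength.dist_unroll_le (h : PreservesArcLength hl I) {p q : Plane}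
    (hp : p ∈ Strip) (hq : q ∈ Strip) :
    dist (unroll hl I p) (unroll hl I q) ≤ dist p q := by
  have hq' : p + (q - p) ∈ Strip := by rwa [add_sub_cancel]
  have h1 := h.eVariationOn_unroll zero_le_one
    (fun t ht => add_smul_mem_strip hp hq' ht)
  have h2 := eVariationOn_line_le p (q - p) zero_le_one
  rw [← h1] at h2
  have h3 := (eVariationOn.edist_le (fun t : ℝ => unroll hl I (p + t • (q - p)))
    (Set.left_mem_Icc.2 zero_le_one) (Set.right_mem_Icc.2 (zero_le_one (α := ℝ)))).trans h2
  simp only [zero_smul, add_zero, one_smul, add_sub_cancel, sub_zero, mul_one] at h3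
  rw [edist_le_ofReal (norm_nonneg _)] at h3
  rwa [dist_comm p q, dist_eq_norm q p]

theorem PreservesArcLength.continuousOn_unroll (h : PreservesArcLength hl I) :
    ContinuousOn (unroll hl I) Strip :=
  (LipschitzOnWith.of_dist_le_mul (K := 1) fun p hp q hq => by
    simpa using h.dist_unroll_le hp hq).continuousOn

/-- The map is 1-Lipschitz, which gives `≤`. If the derivative shrank `v` at `p`, then by continuity
it would shrink `v` by a definite amount along a short segment, whose image would be too short. -/
theorem IsSmoothPaperMoebius.norm_fderiv_unroll (h : IsSmoothPaperMoebius hl I) {p : Plane}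
    (hp : p ∈ OpenStrip) (v : Plane) : ‖fderiv ℝ (unroll hl I) p v‖ = ‖v‖ := by
  have hnhds : OpenStrip ∈ nhds p := isOpen_openStrip.mem_nhds hp
  have hlip : LipschitzOnWith 1 (unroll hl I) OpenStrip :=
    LipschitzOnWith.of_dist_le_mul fun p hp q hq => by
      simpa using h.isometric.dist_unroll_le (openStrip_subset hp) (openStrip_subset hq)
  refine le_antisymm ?_ ?_
  · calc _ ≤ ‖fderiv ℝ (unroll hl I) p‖ * ‖v‖ := ContinuousLinearMap.le_opNorm _ _
      _ ≤ 1 * ‖v‖ := by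
        gcongr
        exact norm_fderiv_le_of_lipschitzOn ℝ hnhds hlip
      _ = ‖v‖ := one_mul _
  by_contra! hlt
  obtain ⟨r, hr1, hr2⟩ := exists_between hlt
  have hr0 : 0 ≤ r := (norm_nonneg _).trans hr1.le
  have hcont : ContinuousOn (fun q => ‖fderiv ℝ (unroll hl I) q v‖) OpenStrip :=
    ((h.smooth.contDiffOn_unroll.continuousOn_fderiv_of_isOpen isOpen_openStrip
      (by simp)).clm_apply continuousOn_const).norm
  have hev : ∀ᶠ q in nhds p, q ∈ OpenStrip ∧ ‖fderiv ℝ (unroll hl I) q v‖ < r :=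
    Filter.Eventually.and hnhds ((hcont.continuousAt hnhds).eventually_lt_const hr1)
  have hline : Filter.Tendsto (fun t : ℝ => p + t • v) (nhds 0) (nhds p) := by
    have : Continuous fun t : ℝ => p + t • v := by fun_prop
    simpa using this.tendsto 0
  obtain ⟨ε, hε, hball⟩ := Metric.eventually_nhds_iff.1 (hline.eventually hev)
  set δ := ε / 2
  have hδ0 : 0 < δ := by positivity
  have hmem : ∀ t ∈ Set.Icc 0 δ, p + t • v ∈ OpenStrip ∧
      ‖fderiv ℝ (unroll hl I) (p + t • v) v‖ < r := fun t ht => hball (by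
    rw [Real.dist_eq, sub_zero, abs_of_nonneg ht.1]
    exact ht.2.trans_lt (half_lt_self hε))
  have hL : LipschitzOnWith r.toNNReal (fun t : ℝ => unroll hl I (p + t • v)) (Set.Icc 0 δ) := by
    refine (convex_Icc (0 : ℝ) δ).lipschitzOnWith_of_nnnorm_hasDerivWithin_le
      (f' := fun t => fderiv ℝ (unroll hl I) (p + t • v) v) (fun t ht => ?_) (fun t ht => ?_)
    · have hd : HasFDerivAt (unroll hl I) (fderiv ℝ (unroll hl I) (p + t • v)) (p + t • v) :=
        ((h.smooth.contDiffOn_unroll.differentiableOn (by simp)).differentiableAt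
          (isOpen_openStrip.mem_nhds (hmem t ht).1)).hasFDerivAt
      have hg : HasDerivAt (fun t : ℝ => p + t • v) v t := by
        simpa using ((hasDerivAt_id t).smul_const v).const_add p
      exact (hd.comp_hasDerivAt t hg).hasDerivWithinAt
    · rw [← NNReal.coe_le_coe, coe_nnnorm, Real.coe_toNNReal _ hr0]
      exact (hmem t ht).2.le
  have h1 := hL.comp_eVariationOn_le (g := fun t : ℝ => t) (s := Set.Icc 0 δ) (fun t ht => ht)
  have h2 := eVariationOn_id_Icc_le hδ0.le
  have h3 := h.isometric.eVariationOn_unroll hδ0.le (fun t ht => openStrip_subset (hmem t ht).1)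
  have h4 := eVariationOn.edist_le (fun t : ℝ => p + t • v)
    (Set.right_mem_Icc.2 hδ0.le) (Set.left_mem_Icc.2 hδ0.le)
  rw [← h3] at h4
  have h5 := h4.trans (h1.trans (mul_le_mul_right h2 _))
  rw [ENNReal.ofNNReal_toNNReal, ← ENNReal.ofReal_mul hr0, edist_le_ofReal (by positivity),
    sub_zero, zero_smul, add_zero, dist_self_add_left, norm_smul, Real.norm_of_nonneg hδ0.le] at h5
  nlinarith

/-- The glide reflection that generates the deck transformations of the strip. -/
noncomputable def glide (l : ℝ) (p : Plane) : Plane := !₂[p 0 + l, 1 - p 1]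

@[simp] theorem glide_zero (l : ℝ) (p : Plane) : glide l p 0 = p 0 + l := rfl
@[simp] theorem glide_one (l : ℝ) (p : Plane) : glide l p 1 = 1 - p 1 := rfl

theorem glide_mem_strip {p : Plane} (hp : p ∈ Strip) : glide l p ∈ Strip :=
  ⟨by simp [hp.2], by simp [hp.1]⟩

theorem glide_mem_openStrip {p : Plane} (hp : p ∈ OpenStrip) : glide l p ∈ OpenStrip :=
  ⟨by simp [hp.2], by simp [hp.1]⟩

theorem unroll_glide {p : Plane} (hp : p ∈ Strip) :
    unroll hl I (glide l p) = unroll hl I p := by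
  rw [unroll_of_mem hp, unroll_of_mem (glide_mem_strip hp)]
  congr 1
  unfold cover
  congr 1
  refine Subtype.ext (plane_ext ?_ ?_)
  · change toIcoMod hl 0 (p 0 + l) = toIcoMod hl 0 (p 0)
    rw [toIcoMod_add_right]
  · change (if Even (toIcoDiv hl 0 (p 0 + l)) then 1 - p 1 else 1 - (1 - p 1)) =
      if Even (toIcoDiv hl 0 (p 0)) then p 1 else 1 - p 1
    simp only [toIcoDiv_add_right, Int.even_add_one, sub_sub_cancel]
    split_ifs <;> rfl

theorem exists_int_of_unroll_eq (hI : Function.Injective I) {p q : Plane} (hp : p ∈ Strip)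
    (hq : q ∈ Strip) (h : unroll hl I p = unroll hl I q) :
    ∃ n : ℤ, q 0 = p 0 + n * l ∧ q 1 = if Even n then p 1 else 1 - p 1 := by
  rw [unroll_of_mem hp, unroll_of_mem hq] at h
  have hrel := Quotient.exact (hI h)
  -- Folded points have first coordinate in [0, l), so the gluing relation between two of them
  -- reduces to equality.
  have hlt : ∀ r : Strip, (foldPoint hl r : Plane) 0 ≠ l := fun r => by
    have := (toIcoMod_mem_Ico hl 0 (r.1 0)).2
    rw [zero_add] at this
    exact this.ne
  have heq : foldPoint hl ⟨p, hp⟩ = foldPoint hl ⟨q, hq⟩ := by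
    rcases hrel with h | h | h
    · exact h
    · exact absurd h.2.1 (hlt _)
    · exact absurd h.2.1 (hlt _)
  have h0 : toIcoMod hl 0 (p 0) = toIcoMod hl 0 (q 0) := congrArg (fun r : Rect l => (r : Plane) 0) heq
  have h1 : (if Even (toIcoDiv hl 0 (p 0)) then p 1 else 1 - p 1) =
      if Even (toIcoDiv hl 0 (q 0)) then q 1 else 1 - q 1 :=
    congrArg (fun r : Rect l => (r : Plane) 1) heq
  refine ⟨toIcoDiv hl 0 (q 0) - toIcoDiv hl 0 (p 0), ?_, ?_⟩
  · simp only [toIcoMod, zsmul_eq_mul] at h0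
    push_cast
    linarith
  · simp only [Int.even_sub]
    split_ifs at h1 ⊢ <;> first | linarith | tauto

/-! ### Calculus of directional derivatives. -/

section Directional

variable {F : Type*} [NormedAddCommGroup F] [NormedSpace ℝ F] {S : Set Plane}

/-- The derivative of `f` at `p` in the direction `v`. -/
noncomputable def dir (v : Plane) (f : Plane → F) (p : Plane) : F := fderiv ℝ f p v

theorem dir_add (v w : Plane) (f : Plane → F) (p : Plane) :
    dir (v + w) f p = dir v f p + dir w f p := map_add _ _ _

theorem dir_smul (c : ℝ) (v : Plane) (f : Plane → F) (p : Plane) :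
    dir (c • v) f p = c • dir v f p := map_smul _ _ _

theorem contDiffOn_dir (hS : IsOpen S) {f : Plane → F} (hf : ContDiffOn ℝ ∞ f S) (v : Plane) :
    ContDiffOn ℝ ∞ (dir v f) S :=
  (hf.fderiv_of_isOpen hS (by simp)).clm_apply contDiffOn_const

theorem differentiableAt_of_mem (hS : IsOpen S) {f : Plane → F} (hf : ContDiffOn ℝ ∞ f S)
    {p : Plane} (hp : p ∈ S) : DifferentiableAt ℝ f p :=
  (hf.differentiableOn (by simp)).differentiableAt (hS.mem_nhds hp)

theorem dir_congr (hS : IsOpen S) {f g : Plane → F} (h : Set.EqOn f g S) (v : Plane) :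
    Set.EqOn (dir v f) (dir v g) S := fun p hp => by
  have : f =ᶠ[nhds p] g := Filter.eventuallyEq_of_mem (hS.mem_nhds hp) h
  simp only [dir, this.fderiv_eq]

theorem dir_const (hS : IsOpen S) {f : Plane → F} {c : F} (h : ∀ p ∈ S, f p = c) (v : Plane)
    {p : Plane} (hp : p ∈ S) : dir v f p = 0 := by
  rw [dir_congr hS (g := fun _ => c) h v hp]
  simp [dir]

theorem dir_comm (hS : IsOpen S) {f : Plane → F} (hf : ContDiffOn ℝ ∞ f S) (v w : Plane)
    {p : Plane} (hp : p ∈ S) : dir v (dir w f) p = dir w (dir v f) p := by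
  have hd : DifferentiableAt ℝ (fderiv ℝ f) p :=
    ((hf.fderiv_of_isOpen hS (m := ∞) (by simp)).differentiableOn (by simp)).differentiableAt
      (hS.mem_nhds hp)
  have key : ∀ v w : Plane, dir v (dir w f) p = fderiv ℝ (fderiv ℝ f) p v w := fun v w => by
    unfold dir
    rw [fderiv_clm_apply hd (by fun_prop)]
    simp
  rw [key, key]
  refine (ContDiffAt.isSymmSndFDerivAt (hf.contDiffAt (hS.mem_nhds hp)) ?_).eq v w
  simpa using WithTop.coe_le_coe.2 (le_top (a := (2 : ℕ∞)))

theorem hasDerivAt_dir_line {f : Plane → F} {p v : Plane} {t : ℝ}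
    (hf : DifferentiableAt ℝ f (p + t • v)) :
    HasDerivAt (fun t : ℝ => f (p + t • v)) (dir v f (p + t • v)) t := by
  have hg : HasDerivAt (fun t : ℝ => p + t • v) v t := by
    simpa using ((hasDerivAt_id t).smul_const v).const_add p
  exact hf.hasFDerivAt.comp_hasDerivAt t hg

theorem dir_inner {f g : Plane → Space} {p : Plane} (hf : DifferentiableAt ℝ f p)
    (hg : DifferentiableAt ℝ g p) (v : Plane) :
    dir v (fun q => inner ℝ (f q) (g q)) p =
      inner ℝ (f p) (dir v g p) + inner ℝ (dir v f p) (g p) :=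
  fderiv_inner_apply ℝ hf hg v

theorem dir_mul {f g : Plane → ℝ} {p : Plane} (hf : DifferentiableAt ℝ f p)
    (hg : DifferentiableAt ℝ g p) (v : Plane) :
    dir v (fun q => f q * g q) p = f p * dir v g p + dir v f p * g p := by
  unfold dir
  rw [fderiv_fun_mul hf hg]
  simp [mul_comm]

end Directional

/-! ### The cross product. -/

section Cross

/-- The cross product in three-space. -/
noncomputable def cross (a b : Space) : Space :=
  !₂[a 1 * b 2 - a 2 * b 1, a 2 * b 0 - a 0 * b 2, a 0 * b 1 - a 1 * b 0]

theorem inner_eq_sum (a b : Space) : inner ℝ a b = a 0 * b 0 + a 1 * b 1 + a 2 * b 2 := by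
  simp [PiLp.inner_apply, Fin.sum_univ_three, mul_comm]

@[simp] theorem cross_apply_zero (a b : Space) : cross a b 0 = a 1 * b 2 - a 2 * b 1 := rfl
@[simp] theorem cross_apply_one (a b : Space) : cross a b 1 = a 2 * b 0 - a 0 * b 2 := rfl
@[simp] theorem cross_apply_two (a b : Space) : cross a b 2 = a 0 * b 1 - a 1 * b 0 := rfl

theorem inner_cross_left (a b : Space) : inner ℝ a (cross a b) = 0 := by
  rw [inner_eq_sum]; simp; ring

theorem inner_cross_right (a b : Space) : inner ℝ b (cross a b) = 0 := by
  rw [inner_eq_sum]; simp; ring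

theorem inner_cross_self (a b : Space) :
    inner ℝ (cross a b) (cross a b) = inner ℝ a a * inner ℝ b b - inner ℝ a b ^ 2 := by
  simp only [inner_eq_sum, cross_apply_zero, cross_apply_one, cross_apply_two]; ring

theorem cross_cross_eq (a b z : Space) :
    cross z (cross a b) = inner ℝ z b • a - inner ℝ z a • b := by
  ext i
  fin_cases i <;>
  simp only [inner_eq_sum, PiLp.sub_apply, PiLp.smul_apply, smul_eq_mul, Fin.zero_eta, Fin.mk_one,
    Fin.reduceFinMk, cross_apply_zero, cross_apply_one, cross_apply_two] <;> ring

theorem cross_neg_right (a b : Space) : cross a (-b) = -cross a b := by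
  ext i
  fin_cases i <;> simp <;> ring

/-- A vector orthogonal to `a` and `b` is a multiple of their cross product. -/
theorem smul_cross_eq {a b z : Space} (ha : inner ℝ z a = 0) (hb : inner ℝ z b = 0) :
    inner ℝ (cross a b) (cross a b) • z = inner ℝ z (cross a b) • cross a b := by
  -- The triple product formula gives z × n = 0 for n = a × b, which is the equality case of
  -- Cauchy–Schwarz.
  have h := cross_cross_eq a b z
  rw [ha, hb, zero_smul, zero_smul, sub_zero] at h
  have h2 := inner_cross_self z (cross a b)
  rw [h, inner_zero_left] at h2
  set n := cross a b
  rw [← sub_eq_zero, ← inner_self_eq_zero (𝕜 := ℝ)]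
  simp only [inner_sub_left, inner_sub_right, inner_smul_left, inner_smul_right,
    real_inner_comm z n, RCLike.conj_to_real]
  linear_combination (-inner ℝ n n) * h2

theorem contDiffOn_cross {S : Set Plane} {f g : Plane → Space} (hf : ContDiffOn ℝ ∞ f S)
    (hg : ContDiffOn ℝ ∞ g S) : ContDiffOn ℝ ∞ (fun p => cross (f p) (g p)) S := by
  rw [contDiffOn_euclidean] at hf hg ⊢
  intro i
  fin_cases i
  · exact ((hf 1).mul (hg 2)).sub ((hf 2).mul (hg 1))
  · exact ((hf 2).mul (hg 0)).sub ((hf 0).mul (hg 2))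
  · exact ((hf 0).mul (hg 1)).sub ((hf 1).mul (hg 0))

end Cross

/-! ### Second fundamental form; Gauss and Codazzi equations. -/

/-- The first vector of the standard basis of the plane. -/
noncomputable def e₀ : Plane := !₂[1, 0]

/-- The second vector of the standard basis of the plane. -/
noncomputable def e₁ : Plane := !₂[0, 1]

@[simp] theorem e₀_zero : e₀ 0 = 1 := rfl
@[simp] theorem e₀_one : e₀ 1 = 0 := rfl
@[simp] theorem e₁_zero : e₁ 0 = 0 := rfl
@[simp] theorem e₁_one : e₁ 1 = 1 := rfl

/-- The unit normal of a parametrized surface with orthonormal coordinates. -/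
noncomputable def normal (X : Plane → Space) (p : Plane) : Space :=
  cross (dir e₀ X p) (dir e₁ X p)

/-- The second fundamental form of a parametrized surface. -/
noncomputable def sff (X : Plane → Space) (v w p : Plane) : ℝ :=
  inner ℝ (dir v (dir w X) p) (normal X p)

theorem sff_add_left (X : Plane → Space) (v w z p : Plane) : sff X (v + w) z p = sff X v z p + sff X w z p := by
  rw [sff, dir_add, inner_add_left]; rfl

theorem sff_smul_left (X : Plane → Space) (c : ℝ) (v z p : Plane) : sff X (c • v) z p = c * sff X v z p := by
  rw [sff, dir_smul, inner_smul_left]; rfl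

/-- `X` is a smooth local isometry of the open set `S` into three-space. -/
structure IsFlatSurface (X : Plane → Space) (S : Set Plane) : Prop where
  isOpen : IsOpen S
  contDiffOn : ContDiffOn ℝ ∞ X S
  norm_dir : ∀ p ∈ S, ∀ v, ‖dir v X p‖ = ‖v‖

namespace IsFlatSurface

variable {X : Plane → Space} {S : Set Plane} (h : IsFlatSurface X S)
include h

theorem inner_dir {p : Plane} (hp : p ∈ S) (v w : Plane) :
    inner ℝ (dir v X p) (dir w X p) = inner ℝ v w := by
  have h1 := norm_add_sq_real (dir v X p) (dir w X p)
  have h2 := norm_add_sq_real v w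
  rw [← dir_add, h.norm_dir p hp, h.norm_dir p hp, h.norm_dir p hp] at h1
  linarith

theorem contDiffOn_dir (v : Plane) : ContDiffOn ℝ ∞ (dir v X) S :=
  PaperMoebius.contDiffOn_dir h.isOpen h.contDiffOn v

theorem contDiffOn_dir_dir (v w : Plane) : ContDiffOn ℝ ∞ (dir v (dir w X)) S :=
  PaperMoebius.contDiffOn_dir h.isOpen (h.contDiffOn_dir w) v

theorem contDiffOn_normal : ContDiffOn ℝ ∞ (normal X) S :=
  contDiffOn_cross (h.contDiffOn_dir e₀) (h.contDiffOn_dir e₁)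

theorem contDiffOn_sff (v w : Plane) : ContDiffOn ℝ ∞ (sff X v w) S :=
  (h.contDiffOn_dir_dir v w).inner ℝ h.contDiffOn_normal

theorem differentiableAt {F : Type*} [NormedAddCommGroup F] [NormedSpace ℝ F] {f : Plane → F}
    (hf : ContDiffOn ℝ ∞ f S) {p : Plane} (hp : p ∈ S) : DifferentiableAt ℝ f p :=
  differentiableAt_of_mem h.isOpen hf hp

theorem inner_normal_self {p : Plane} (hp : p ∈ S) :
    inner ℝ (normal X p) (normal X p) = 1 := by
  rw [normal, inner_cross_self, h.inner_dir hp, h.inner_dir hp, h.inner_dir hp]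
  simp only [PiLp.inner_apply, Fin.sum_univ_two]
  simp

/-- The second derivatives of `X` are orthogonal to the first ones. -/
theorem inner_dir_dir {p : Plane} (hp : p ∈ S) (v w z : Plane) :
    inner ℝ (dir v (dir w X) p) (dir z X p) = 0 := by
  -- An expression in three directions that is antisymmetric in the last two and symmetric in the
  -- first two vanishes.
  have anti : ∀ v w z : Plane, inner ℝ (dir v (dir w X) p) (dir z X p) =
      -inner ℝ (dir v (dir z X) p) (dir w X p) := fun v w z => by
    have h1 := dir_inner (h.differentiableAt (h.contDiffOn_dir w) hp)
      (h.differentiableAt (h.contDiffOn_dir z) hp) v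
    rw [dir_const h.isOpen (fun q hq => h.inner_dir hq w z) v hp, real_inner_comm] at h1
    linarith
  have symm : ∀ v w z : Plane, inner ℝ (dir v (dir w X) p) (dir z X p) =
      inner ℝ (dir w (dir v X) p) (dir z X p) := fun v w z => by
    rw [dir_comm h.isOpen h.contDiffOn v w hp]
  have h1 := anti v w z
  have h2 := symm v z w
  have h3 := anti z v w
  have h4 := symm z w v
  have h5 := anti w z v
  have h6 := symm w v z
  linarith

theorem dir_dir_eq {p : Plane} (hp : p ∈ S) (v w : Plane) :
    dir v (dir w X) p = sff X v w p • normal X p := by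
  have := smul_cross_eq (h.inner_dir_dir hp v w e₀) (h.inner_dir_dir hp v w e₁)
  change inner ℝ (normal X p) (normal X p) • _ = _ • normal X p at this
  rwa [h.inner_normal_self hp, one_smul] at this

theorem sff_comm {p : Plane} (hp : p ∈ S) (v w : Plane) : sff X v w p = sff X w v p := by
  rw [sff, sff, dir_comm h.isOpen h.contDiffOn v w hp]

/-- Since X_vw is parallel to the unit normal N and dN ⊥ N, the derivative of the form is ⟨X_zvw,
N⟩, which is symmetric in z and v. -/
theorem codazzi {p : Plane} (hp : p ∈ S) (v w z : Plane) :
    dir z (sff X v w) p = dir v (sff X z w) p := by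
  have hN : ∀ z : Plane, inner ℝ (normal X p) (dir z (normal X) p) = 0 := fun z => by
    have h1 := dir_inner (h.differentiableAt h.contDiffOn_normal hp)
      (h.differentiableAt h.contDiffOn_normal hp) z
    rw [dir_const h.isOpen (fun q hq => h.inner_normal_self hq) z hp,
      real_inner_comm (normal X p) (dir z (normal X) p)] at h1
    linarith
  have key : ∀ v z : Plane, dir z (sff X v w) p =
      inner ℝ (dir z (dir v (dir w X)) p) (normal X p) := fun v z => by
    have h1 := dir_inner (h.differentiableAt (h.contDiffOn_dir_dir v w) hp)
      (h.differentiableAt h.contDiffOn_normal hp) z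
    rw [h.dir_dir_eq hp, inner_smul_left, hN, mul_zero, zero_add] at h1
    exact h1
  rw [key, key, dir_comm h.isOpen (h.contDiffOn_dir w) z v hp]

/-- Differentiate ⟨X_vv, X_w⟩ = 0 along w and ⟨X_vw, X_w⟩ = 0 along v: the third-order terms agree,
leaving ⟨X_vv, X_ww⟩ = ⟨X_vw, X_vw⟩. -/
theorem gauss {p : Plane} (hp : p ∈ S) (v w : Plane) :
    sff X v v p * sff X w w p = sff X v w p ^ 2 := by
  have h1 := dir_inner (h.differentiableAt (h.contDiffOn_dir_dir v v) hp)
    (h.differentiableAt (h.contDiffOn_dir w) hp) w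
  have h2 := dir_inner (h.differentiableAt (h.contDiffOn_dir_dir v w) hp)
    (h.differentiableAt (h.contDiffOn_dir w) hp) v
  rw [dir_const h.isOpen (fun q hq => h.inner_dir_dir hq _ _ _) _ hp] at h1 h2
  have h3 : dir w (dir v (dir v X)) p = dir v (dir v (dir w X)) p := by
    rw [dir_comm h.isOpen (h.contDiffOn_dir v) w v hp]
    exact dir_congr h.isOpen (fun q hq => dir_comm h.isOpen h.contDiffOn w v hq) v hp
  rw [h3] at h1
  have h4 : inner ℝ (dir v (dir v X) p) (dir w (dir w X) p) =
      inner ℝ (dir v (dir w X) p) (dir v (dir w X) p) := by linarith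
  rw [h.dir_dir_eq hp, h.dir_dir_eq hp, h.dir_dir_eq hp] at h4
  simp only [inner_smul_left, inner_smul_right, h.inner_normal_self hp, RCLike.conj_to_real] at h4
  linarith

end IsFlatSurface

/-! ### Propagation of the kernel along rulings. -/

theorem ne_zero_of_mul_eq_one {G H : ℝ → ℝ} {T : ℝ} (hG : ContinuousOn G (Set.Icc 0 T))
    (hH : Continuous H) (h0 : G 0 ≠ 0)
    (hP : ∀ t ∈ Set.Icc 0 T, (∀ s ∈ Set.Icc 0 t, G s ≠ 0) → G t * H t = 1) :
    ∀ t ∈ Set.Icc 0 T, G t ≠ 0 := by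
  by_contra! hne
  -- At the first zero of G, the identity G * H = 1 valid before it would persist by continuity.
  set Z := Set.Icc 0 T ∩ G ⁻¹' {0} with hZ
  have hZc : IsClosed Z := hG.preimage_isClosed_of_isClosed isClosed_Icc isClosed_singleton
  have hZne : Z.Nonempty := hne
  have hZb : BddBelow Z := ⟨0, fun t ht => ht.1.1⟩
  set τ := sInf Z with hτ
  have hτZ : τ ∈ Z := hZc.csInf_mem hZne hZb
  have hτ0 : G τ = 0 := hτZ.2
  have hpos : 0 < τ := lt_of_le_of_ne hτZ.1.1 (fun h => h0 (h ▸ hτ0))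
  have hlt : ∀ t ∈ Set.Ico 0 τ, G t ≠ 0 := fun t ht h =>
    absurd (csInf_le hZb ⟨⟨ht.1, ht.2.le.trans hτZ.1.2⟩, h⟩) (not_le.2 ht.2)
  have heq : Set.EqOn (fun t => G t * H t) (fun _ => 1) (Set.Ico 0 τ) := fun t ht =>
    hP t ⟨ht.1, ht.2.le.trans hτZ.1.2⟩ fun s hs => hlt s ⟨hs.1, hs.2.trans_lt ht.2⟩
  have heq' := heq.of_subset_closure (t := Set.Icc 0 τ)
    ((hG.mono (Set.Icc_subset_Icc_right hτZ.1.2)).mul hH.continuousOn) continuousOn_const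
    Set.Ico_subset_Icc_self (by rw [closure_Ico hpos.ne])
  have := heq' (Set.right_mem_Icc.2 hpos.le)
  simp [hτ0] at this

/-- A solution of a homogeneous linear equation with zero initial value vanishes. -/
theorem eq_zero_of_linear_ode {f f' c : ℝ → ℝ} {T : ℝ}
    (hf : ∀ t ∈ Set.Icc 0 T, HasDerivAt f (f' t) t) (hc : ContinuousOn c (Set.Icc 0 T))
    (hfc : ∀ t ∈ Set.Icc 0 T, f' t = c t * f t) (h0 : f 0 = 0) :
    ∀ t ∈ Set.Icc 0 T, f t = 0 := by
  obtain ⟨K, hK⟩ := isCompact_Icc.exists_bound_of_continuousOn hc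
  refine eq_zero_of_abs_deriv_le_mul_abs_self_of_eq_zero_right (f' := f') (K := K)
    (fun t ht => (hf t ht).continuousAt.continuousWithinAt)
    (fun t ht => (hf t (Set.Ico_subset_Icc_self ht)).hasDerivWithinAt) h0 fun t ht => ?_
  rw [hfc t (Set.Ico_subset_Icc_self ht), norm_mul]
  gcongr
  exact hK t (Set.Ico_subset_Icc_self ht)

theorem eq_initial_of_hasDerivAt_zero {F : Type*} [NormedAddCommGroup F] [NormedSpace ℝ F]
    {f : ℝ → F} {T : ℝ}
    (hf : ∀ t ∈ Set.Icc 0 T, HasDerivAt f 0 t) : ∀ t ∈ Set.Icc 0 T, f t = f 0 :=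
  constant_of_has_deriv_right_zero (fun t ht => (hf t ht).continuousAt.continuousWithinAt)
    fun t ht => (hf t (Set.Ico_subset_Icc_self ht)).hasDerivWithinAt

/-- The coefficients `e`, `f`, `g` of a degenerate symmetric form satisfying the Codazzi equations
keep the direction `v` in their kernel along the line in this direction, and stay nonzero. -/
theorem eq_zero_and_ne_zero_of_codazzi {S : Set Plane} (hS : IsOpen S) (hconv : Convex ℝ S)
    {e f g : Plane → ℝ} (he : ContDiffOn ℝ ∞ e S) (hf : ContDiffOn ℝ ∞ f S)
    (hg : ContDiffOn ℝ ∞ g S) {v w : Plane} (hef : ∀ p ∈ S, dir w e p = dir v f p)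
    (hfg : ∀ p ∈ S, dir w f p = dir v g p) (hdet : ∀ p ∈ S, e p * g p = f p ^ 2)
    {p : Plane} (hp : p ∈ S) (hfp : f p = 0) (hgp : g p ≠ 0) {T : ℝ} (hT : 0 ≤ T)
    (hpT : p + T • v ∈ S) :
    f (p + T • v) = 0 ∧ g (p + T • v) ≠ 0 := by
  have hline : ∀ t ∈ Set.Icc 0 T, p + t • v ∈ S := fun t ht => by
    have hseg := hconv.add_smul_sub_mem hp hpT (t := t / T)
      ⟨div_nonneg ht.1 hT, div_le_one_of_le₀ ht.2 hT⟩
    rcases hT.eq_or_lt with h | h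
    · have : t = 0 := le_antisymm (h ▸ ht.2) ht.1
      simpa [this] using hp
    · rwa [add_sub_cancel_left, smul_smul, div_mul_cancel₀ _ h.ne'] at hseg
  have hd : ∀ {k : Plane → ℝ}, ContDiffOn ℝ ∞ k S → ∀ {q}, q ∈ S → DifferentiableAt ℝ k q :=
    fun hk _ hq => differentiableAt_of_mem hS hk hq
  have hcomp : ∀ {k : Plane → ℝ}, ContDiffOn ℝ ∞ k S → ∀ {t}, t ∈ Set.Icc 0 T →
      HasDerivAt (fun t : ℝ => k (p + t • v)) (dir v k (p + t • v)) t :=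
    fun hk t ht => hasDerivAt_dir_line (hd hk (hline t ht))
  have hcont : ∀ {k : Plane → ℝ}, ContDiffOn ℝ ∞ k S →
      ContinuousOn (fun t : ℝ => k (p + t • v)) (Set.Icc 0 T) :=
    fun hk t ht => (hcomp hk ht).continuousAt.continuousWithinAt
  have hfw := contDiffOn_dir hS hf w
  have hgw := contDiffOn_dir hS hg w
  have hew := contDiffOn_dir hS he w
  have I1 : ∀ q ∈ S, e q * dir w g q + dir w e q * g q = f q * dir w f q + dir w f q * f q := by
    intro q hq
    rw [← dir_mul (hd he hq) (hd hg hq), ← dir_mul (hd hf hq) (hd hf hq)]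
    exact dir_congr hS (fun r hr => by simp only [hdet r hr, sq]) w hq
  have I2 : ∀ q ∈ S, (e q * dir w (dir w g) q + dir w e q * dir w g q) +
      (dir w e q * dir w g q + dir w (dir w e) q * g q) =
      (f q * dir w (dir w f) q + dir w f q * dir w f q) +
      (dir w f q * dir w f q + dir w (dir w f) q * f q) := by
    intro q hq
    have hadd : ∀ {k₁ k₂ : Plane → ℝ}, ContDiffOn ℝ ∞ k₁ S → ContDiffOn ℝ ∞ k₂ S →
        dir w (fun r => k₁ r + k₂ r) q = dir w k₁ q + dir w k₂ q := fun h₁ h₂ => by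
      unfold dir
      rw [fderiv_fun_add (hd h₁ hq) (hd h₂ hq)]
      rfl
    rw [← dir_mul (hd he hq) (hd hgw hq), ← dir_mul (hd hew hq) (hd hg hq),
      ← dir_mul (hd hf hq) (hd hfw hq), ← dir_mul (hd hfw hq) (hd hf hq),
      ← hadd (he.mul hgw) (hew.mul hg), ← hadd (hf.mul hfw) (hfw.mul hf)]
    exact dir_congr hS I1 w hq
  -- While g ≠ 0, substituting e = f²/g and e_w = f_v in the w-derivative of eg = f² yields a linear
  -- equation for f along the line.
  have hzero : ∀ t ∈ Set.Icc 0 T, (∀ s ∈ Set.Icc 0 t, g (p + s • v) ≠ 0) →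
      ∀ s ∈ Set.Icc 0 t, f (p + s • v) = 0 := by
    intro t ht hne
    have hsub : Set.Icc 0 t ⊆ Set.Icc 0 T := Set.Icc_subset_Icc_right ht.2
    refine eq_zero_of_linear_ode (f' := fun s => dir v f (p + s • v))
      (c := fun s => (2 * dir w f (p + s • v) * g (p + s • v) -
        f (p + s • v) * dir w g (p + s • v)) / g (p + s • v) ^ 2)
      (fun s hs => hcomp hf (hsub hs)) ?_ (fun s hs => ?_) (by simpa using hfp)
    · exact ((((continuousOn_const.mul (hcont hfw)).mul (hcont hg)).sub
        ((hcont hf).mul (hcont hgw))).mono hsub).div (((hcont hg).pow 2).mono hsub)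
        fun s hs => pow_ne_zero 2 (hne s hs)
    · have hq := hline s (hsub hs)
      have h1 := I1 _ hq
      rw [hef _ hq] at h1
      have h2 := hdet _ hq
      have h3 := hne s hs
      rw [div_mul_eq_mul_div, eq_div_iff (pow_ne_zero 2 h3)]
      linear_combination g (p + s • v) * h1 - dir w g (p + s • v) * h2
  have hne : ∀ t ∈ Set.Icc 0 T, g (p + t • v) ≠ 0 := by
    refine ne_zero_of_mul_eq_one (H := fun t => (g p)⁻¹ - dir w f p / g p ^ 2 * t) (hcont hg)
      (by fun_prop) (by simpa using hgp) fun t ht hne => ?_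
    have hsub : Set.Icc 0 t ⊆ Set.Icc 0 T := Set.Icc_subset_Icc_right ht.2
    have hf0 := hzero t ht hne
    -- Where e = f = e_w = 0, the second w-derivative of eg = f² reads e_ww g = 2 f_w². With (f_w)_v
    -- = e_ww and g_v = f_w this makes f_w/g² constant.
    have c1 : ∀ s ∈ Set.Icc 0 t, dir w f (p + s • v) / g (p + s • v) ^ 2 =
        dir w f p / g p ^ 2 := by
      intro s hs
      have := eq_initial_of_hasDerivAt_zero (T := t)
        (f := fun s => dir w f (p + s • v) / g (p + s • v) ^ 2) (fun s hs => ?_) s hs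
      · simpa using this
      have hq := hline s (hsub hs)
      have hg0 := hne s hs
      have hfs := hf0 s hs
      have hes : e (p + s • v) = 0 := by
        have := hdet _ hq
        rw [hfs] at this
        simpa [hg0] using this
      have hews : dir w e (p + s • v) = 0 := by
        have := I1 _ hq
        rw [hfs, hes] at this
        simpa [hg0] using this
      have hI2 := I2 _ hq
      rw [hfs, hes, hews] at hI2
      have hsw : dir v (dir w f) (p + s • v) = dir w (dir w e) (p + s • v) := by
        rw [dir_comm hS hf v w hq]
        exact (dir_congr hS hef w hq).symm
      have hdiv := (hcomp hfw (hsub hs)).div ((hcomp hg (hsub hs)).pow 2) (pow_ne_zero 2 hg0)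
      refine hdiv.congr_deriv ?_
      rw [hsw, ← hfg _ hq, div_eq_zero_iff]
      left
      simp only [Pi.pow_apply]
      push_cast
      linear_combination g (p + s • v) * hI2
    have c2 := eq_initial_of_hasDerivAt_zero (T := t)
      (f := fun s => (g (p + s • v))⁻¹ + dir w f p / g p ^ 2 * s) (fun s hs => ?_) t
      (Set.right_mem_Icc.2 ht.1)
    · simp only [zero_smul, add_zero, mul_zero] at c2
      have := hne t (Set.right_mem_Icc.2 ht.1)
      rw [← c2, add_sub_cancel_right, mul_inv_cancel₀ this]
    · have h1 := ((hcomp hg (hsub hs)).inv (hne s hs)).add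
        ((hasDerivAt_id s).const_mul (dir w f p / g p ^ 2))
      refine h1.congr_deriv ?_
      rw [← c1 s hs, ← hfg _ (hline s (hsub hs))]
      ring
  have hTT : T ∈ Set.Icc 0 T := Set.right_mem_Icc.2 hT
  exact ⟨hzero T hTT hne T hTT, hne T hTT⟩

/-! ### Chords of the strip and the slope of rulings. -/

/-- The direction vector of slope `k`, as a graph over the vertical axis. -/
noncomputable def chordDir (k : ℝ) : Plane := !₂[k, 1]

/-- The point at height `1 / 2 + t` on the line of direction `(k, 1)` through `(x, 1 / 2)`. -/
noncomputable def chordPoint (x k t : ℝ) : Plane := !₂[x + t * k, 1 / 2 + t]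

@[simp] theorem chordDir_zero (k : ℝ) : chordDir k 0 = k := rfl
@[simp] theorem chordDir_one (k : ℝ) : chordDir k 1 = 1 := rfl
@[simp] theorem chordPoint_zero (x k t : ℝ) : chordPoint x k t 0 = x + t * k := rfl
@[simp] theorem chordPoint_one (x k t : ℝ) : chordPoint x k t 1 = 1 / 2 + t := rfl

theorem chordDir_eq (k : ℝ) : chordDir k = k • e₀ + e₁ := plane_ext (by simp) (by simp)

theorem chordPoint_add_smul (x k s t : ℝ) :
    chordPoint x k s + t • chordDir k = chordPoint x k (s + t) :=
  plane_ext (by simp; ring) (by simp; ring)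

theorem chordPoint_mem_openStrip {x k t : ℝ} (ht : |t| < 1 / 2) :
    chordPoint x k t ∈ OpenStrip := by
  rw [abs_lt] at ht
  exact ⟨by simp; linarith, by simp; linarith⟩

theorem chordPoint_mem_strip {x k t : ℝ} (ht : |t| ≤ 1 / 2) : chordPoint x k t ∈ Strip := by
  rw [abs_le] at ht
  exact ⟨by simp; linarith, by simp; linarith⟩

theorem norm_chordDir_sq (k : ℝ) : ‖chordDir k‖ ^ 2 = 1 + k ^ 2 := by
  rw [EuclideanSpace.real_norm_sq_eq, Fin.sum_univ_two]
  simp [add_comm]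

theorem convex_openStrip : Convex ℝ OpenStrip := by
  intro p hp q hq a b ha hb hab
  have := (convex_Ioo (0 : ℝ) 1) hp hq ha hb hab
  simpa [OpenStrip] using this

namespace IsFlatSurface

variable {X : Plane → Space} {S : Set Plane} (h : IsFlatSurface X S)
include h

theorem sff_along_ruling (hconv : Convex ℝ S) {v w p : Plane} (hp : p ∈ S)
    (hvw : sff X v w p = 0) (hww : sff X w w p ≠ 0) {T : ℝ} (hT : p + T • v ∈ S) :
    sff X v w (p + T • v) = 0 ∧ sff X w w (p + T • v) ≠ 0 := by
  have key : ∀ v : Plane, sff X v w p = 0 → ∀ T : ℝ, 0 ≤ T → p + T • v ∈ S →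
      sff X v w (p + T • v) = 0 ∧ sff X w w (p + T • v) ≠ 0 := fun v hvw T hT0 hT =>
    eq_zero_and_ne_zero_of_codazzi h.isOpen hconv (h.contDiffOn_sff v v) (h.contDiffOn_sff v w)
      (h.contDiffOn_sff w w)
      (fun q hq => (h.codazzi hq v v w).trans
        (dir_congr h.isOpen (fun r hr => h.sff_comm hr w v) v hq))
      (fun q hq => h.codazzi hq v w w) (fun q hq => h.gauss hq v w) hp hvw hww hT0 hT
  rcases le_total 0 T with hT0 | hT0
  · exact key v hvw T hT0 hT
  · have hneg : ∀ q, sff X (-v) w q = -sff X v w q := fun q => by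
      rw [← neg_one_smul ℝ v, sff_smul_left, neg_one_mul]
    have := key (-v) (by rw [hneg, hvw, neg_zero]) (-T) (by linarith) (by simpa using hT)
    rwa [hneg, neg_eq_zero, neg_smul_neg] at this

/-- Second derivatives of X are purely normal, so an asymptotic line has zero acceleration in space.
-/
theorem eq_add_smul_of_sff_eq_zero {p v : Plane} {T : ℝ}
    (hv : ∀ t ∈ Set.uIcc 0 T, p + t • v ∈ S ∧ sff X v v (p + t • v) = 0) :
    X (p + T • v) = X p + T • dir v X p := by
  have key : ∀ v : Plane, ∀ T : ℝ, 0 ≤ T →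
      (∀ t ∈ Set.Icc 0 T, p + t • v ∈ S ∧ sff X v v (p + t • v) = 0) →
      X (p + T • v) = X p + T • dir v X p := by
    intro v T hT hv
    have h1 := eq_initial_of_hasDerivAt_zero (T := T) (f := fun t : ℝ => dir v X (p + t • v))
      (fun t ht => by
        have := hasDerivAt_dir_line (h.differentiableAt (h.contDiffOn_dir v) (hv t ht).1)
        rwa [h.dir_dir_eq (hv t ht).1, (hv t ht).2, zero_smul] at this)
    have h2 := eq_initial_of_hasDerivAt_zero (T := T)
      (f := fun t : ℝ => X (p + t • v) - t • dir v X p) (fun t ht => by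
        have := (hasDerivAt_dir_line (h.differentiableAt h.contDiffOn (hv t ht).1)).sub
          ((hasDerivAt_id t).smul_const (dir v X p))
        refine this.congr_deriv ?_
        have h3 := h1 t ht
        simp only [zero_smul, add_zero] at h3
        rw [h3, one_smul, sub_self]) T (Set.right_mem_Icc.2 hT)
    simp only [zero_smul, add_zero, sub_zero] at h2
    exact eq_add_of_sub_eq h2
  rcases le_total 0 T with hT | hT
  · rw [Set.uIcc_of_le hT] at hv
    exact key v T hT hv
  · rw [Set.uIcc_of_ge hT] at hv
    have hneg : ∀ q, dir (-v) X q = -dir v X q := fun q => by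
      rw [← neg_one_smul ℝ v, dir_smul, neg_one_smul]
    have := key (-v) (-T) (by linarith) fun t ht => by
      have ht' := hv (-t) ⟨by linarith [ht.2], by linarith [ht.1]⟩
      have hc : sff X (-v) (-v) (p + -t • v) = sff X v v (p + -t • v) := by
        rw [← neg_one_smul ℝ v, sff_smul_left, h.sff_comm ht'.1, sff_smul_left]
        ring
      rw [smul_neg, ← neg_smul, hc]
      exact ht'
    rwa [neg_smul_neg, hneg, neg_smul_neg] at this

theorem sff_chordDir {p : Plane} (hp : p ∈ S) (k : ℝ) :
    sff X (chordDir k) e₀ p = k * sff X e₀ e₀ p + sff X e₀ e₁ p ∧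
    sff X (chordDir k) (chordDir k) p =
      k * sff X (chordDir k) e₀ p + (k * sff X e₀ e₁ p + sff X e₁ e₁ p) := by
  have h1 : sff X (chordDir k) e₀ p = k * sff X e₀ e₀ p + sff X e₀ e₁ p := by
    rw [chordDir_eq, sff_add_left, sff_smul_left, h.sff_comm hp e₁]
  refine ⟨h1, ?_⟩
  nth_rewrite 1 [chordDir_eq]
  rw [sff_add_left, sff_smul_left, h.sff_comm hp e₀, h.sff_comm hp e₁]
  nth_rewrite 2 [chordDir_eq]
  rw [sff_add_left, sff_smul_left]

end IsFlatSurface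

/-- The slope of the kernel of the second fundamental form. -/
noncomputable def kernelSlope (X : Plane → Space) (p : Plane) : ℝ :=
  -sff X e₀ e₁ p / sff X e₀ e₀ p

namespace IsFlatSurface

variable {X : Plane → Space} {S : Set Plane} (h : IsFlatSurface X S)
include h

theorem sff_chordDir_eq_zero_iff {p : Plane} (hp : p ∈ S) (hne : sff X e₀ e₀ p ≠ 0) {k : ℝ} :
    sff X (chordDir k) e₀ p = 0 ↔ kernelSlope X p = k := by
  rw [(h.sff_chordDir hp k).1, kernelSlope, div_eq_iff hne]
  constructor <;> intro h <;> linarith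

theorem sff_chordDir_kernelSlope {p : Plane} (hp : p ∈ S) (hne : sff X e₀ e₀ p ≠ 0) :
    sff X (chordDir (kernelSlope X p)) (chordDir (kernelSlope X p)) p = 0 := by
  have h1 := (h.sff_chordDir_eq_zero_iff hp hne).2 rfl
  have h2 := h.gauss hp (chordDir (kernelSlope X p)) e₀
  rw [h1] at h2
  simpa [hne] using h2

theorem kernelSlope_along_ruling (hconv : Convex ℝ S) {p : Plane} (hp : p ∈ S)
    (hne : sff X e₀ e₀ p ≠ 0) {k : ℝ} (hk : kernelSlope X p = k) {T : ℝ}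
    (hT : p + T • chordDir k ∈ S) :
    sff X e₀ e₀ (p + T • chordDir k) ≠ 0 ∧ kernelSlope X (p + T • chordDir k) = k := by
  have := h.sff_along_ruling hconv hp ((h.sff_chordDir_eq_zero_iff hp hne).2 hk) hne hT
  exact ⟨this.2, (h.sff_chordDir_eq_zero_iff hT this.2).1 this.1⟩

end IsFlatSurface

theorem IsSmoothPaperMoebius.isFlatSurface {l : ℝ} {hl : 0 < l} {I : FlatMoebius l → Space}
    (h : IsSmoothPaperMoebius hl I) : IsFlatSurface (unroll hl I) OpenStrip :=
  ⟨isOpen_openStrip, h.smooth.contDiffOn_unroll, fun _ hp v => h.norm_fderiv_unroll hp v⟩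

/-! ### Behavior under the deck transformation. -/

section Glide

theorem dir_glide {F : Type*} [NormedAddCommGroup F] [NormedSpace ℝ F] {f g : Plane → F} {c : ℝ}
    (hf : ContDiffOn ℝ ∞ f OpenStrip) (hg : ContDiffOn ℝ ∞ g OpenStrip)
    (hfg : ∀ p ∈ OpenStrip, f (glide l p) = c • g p) {v v' : Plane} (h0 : v' 0 = v 0)
    (h1 : v' 1 = -v 1) {p : Plane} (hp : p ∈ OpenStrip) :
    dir v f (glide l p) = c • dir v' g p := by
  have hd1 := hasDerivAt_dir_line (v := v) (t := 0) (p := glide l p) (f := f) (by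
    simpa using differentiableAt_of_mem isOpen_openStrip hf (glide_mem_openStrip hp))
  have hd2 := (hasDerivAt_dir_line (v := v') (t := 0) (p := p) (f := g) (by
    simpa using differentiableAt_of_mem isOpen_openStrip hg hp)).const_smul c
  simp only [zero_smul, add_zero] at hd1 hd2
  refine hd1.unique (hd2.congr_of_eventuallyEq ?_)
  have hline : Filter.Tendsto (fun t : ℝ => p + t • v') (nhds 0) (nhds p) := by
    have : Continuous fun t : ℝ => p + t • v' := by fun_prop
    simpa using this.tendsto 0
  filter_upwards [hline.eventually (isOpen_openStrip.mem_nhds hp)] with t ht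
  rw [Pi.smul_apply, ← hfg _ ht]
  congr 1
  exact plane_ext (by simp [h0]; ring) (by simp [h1]; ring)

/-- The glide reverses orientation, so the normal changes sign. X_xx does not and X_xy does, so the
quotient defining the slope is negated. -/
theorem kernelSlope_glide {X : Plane → Space} (h : IsFlatSurface X OpenStrip)
    (hX : ∀ p ∈ OpenStrip, X (glide l p) = X p) {p : Plane} (hp : p ∈ OpenStrip) :
    sff X e₀ e₀ (glide l p) = -sff X e₀ e₀ p ∧ kernelSlope X (glide l p) = -kernelSlope X p := by
  have h0 : ∀ p ∈ OpenStrip, dir e₀ X (glide l p) = (1 : ℝ) • dir e₀ X p := fun p hp =>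
    dir_glide h.contDiffOn h.contDiffOn (fun q hq => by rw [hX q hq, one_smul]) rfl (by simp) hp
  have h1 : ∀ p ∈ OpenStrip, dir e₁ X (glide l p) = (-1 : ℝ) • dir e₁ X p := fun p hp => by
    have := dir_glide (v := e₁) (v' := (-1 : ℝ) • e₁) (c := 1) h.contDiffOn h.contDiffOn
      (fun q hq => by rw [hX q hq, one_smul]) (by simp) (by simp) hp
    rw [this, dir_smul, one_smul]
  have h00 : dir e₀ (dir e₀ X) (glide l p) = (1 : ℝ) • dir e₀ (dir e₀ X) p :=
    dir_glide (h.contDiffOn_dir _) (h.contDiffOn_dir _) h0 rfl (by simp) hp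
  have h01 : dir e₀ (dir e₁ X) (glide l p) = (-1 : ℝ) • dir e₀ (dir e₁ X) p :=
    dir_glide (h.contDiffOn_dir _) (h.contDiffOn_dir _) h1 rfl (by simp) hp
  have hN : normal X (glide l p) = -normal X p := by
    rw [normal, h0 p hp, h1 p hp, one_smul, neg_one_smul, cross_neg_right, normal]
  have s0 : sff X e₀ e₀ (glide l p) = -sff X e₀ e₀ p := by
    rw [sff, h00, hN, one_smul, inner_neg_right, sff]
  have s1 : sff X e₀ e₁ (glide l p) = sff X e₀ e₁ p := by
    rw [sff, h01, hN, neg_one_smul, inner_neg_neg, sff]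
  exact ⟨s0, by rw [kernelSlope, s0, s1, div_neg, kernelSlope]⟩

end Glide

/-! ### Noncrossing rulings and straight chords. -/

section Chords

variable {X : Plane → Space} (h : IsFlatSurface X OpenStrip)
include h

/-- On a flat surface with an isometric period, the second fundamental form cannot have a
horizontal kernel, as the corresponding asymptotic line would be an unbounded line in space. -/
theorem IsFlatSurface.sff_e₁_eq_zero {l : ℝ} (hl : 0 < l)
    (hX : ∀ p ∈ OpenStrip, X (glide l p) = X p) {p : Plane} (hp : p ∈ OpenStrip)
    (hp0 : sff X e₀ e₀ p = 0) : sff X e₀ e₁ p = 0 ∧ sff X e₁ e₁ p = 0 := by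
  have hf : sff X e₀ e₁ p = 0 := by
    have := h.gauss hp e₀ e₁
    rw [hp0, zero_mul] at this
    exact pow_eq_zero_iff two_ne_zero |>.1 this.symm
  refine ⟨hf, ?_⟩
  by_contra hne
  have hmem : ∀ t : ℝ, p + t • e₀ ∈ OpenStrip := fun t => by simpa [OpenStrip] using hp
  have hzero : ∀ t : ℝ, sff X e₀ e₀ (p + t • e₀) = 0 := fun t => by
    obtain ⟨h1, h2⟩ := h.sff_along_ruling convex_openStrip hp hf hne (hmem t)
    have := h.gauss (hmem t) e₀ e₁
    rw [h1] at this
    simpa [h2] using this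
  -- Length 2l, because the square of the glide is the translation by 2l: the straight image line
  -- would return to its starting point.
  have h1 := h.eq_add_smul_of_sff_eq_zero (p := p) (v := e₀) (T := 2 * l)
    fun t _ => ⟨hmem t, hzero t⟩
  have h2 : p + (2 * l) • e₀ = glide l (glide l p) :=
    plane_ext (by simp; ring) (by simp)
  rw [h2, hX _ (glide_mem_openStrip hp), hX _ hp, left_eq_add, smul_eq_zero] at h1
  have h3 := h.norm_dir p hp e₀
  rw [h1.resolve_left (by positivity), norm_zero] at h3
  have h4 := norm_eq_zero.1 h3.symm
  simpa using congrArg (fun v : Plane => v 0) h4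

/-- Rulings do not cross: their slopes are Lipschitz functions of their midpoints. -/
theorem IsFlatSurface.abs_kernelSlope_sub_le {x x' : ℝ}
    (hx : sff X e₀ e₀ (chordPoint x 0 0) ≠ 0) (hx' : sff X e₀ e₀ (chordPoint x' 0 0) ≠ 0) :
    |kernelSlope X (chordPoint x 0 0) - kernelSlope X (chordPoint x' 0 0)| ≤ 2 * |x - x'| := by
  have hrul : ∀ x, sff X e₀ e₀ (chordPoint x 0 0) ≠ 0 → ∀ k,
      kernelSlope X (chordPoint x 0 0) = k → ∀ t : ℝ, |t| < 1 / 2 →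
      kernelSlope X (chordPoint x k t) = k := by
    intro x hx k hk t ht
    have h0 : chordPoint x 0 0 = chordPoint x k 0 := plane_ext (by simp) (by simp)
    rw [h0] at hx hk
    have := (h.kernelSlope_along_ruling (T := t) convex_openStrip
      (chordPoint_mem_openStrip (by norm_num)) hx hk
      (by rw [chordPoint_add_smul, zero_add]; exact chordPoint_mem_openStrip ht)).2
    rwa [chordPoint_add_smul, zero_add] at this
  set k := kernelSlope X (chordPoint x 0 0) with hk
  set k' := kernelSlope X (chordPoint x' 0 0) with hk'
  by_contra! hlt
  have hne : k - k' ≠ 0 := fun h0 => by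
    rw [h0, abs_zero] at hlt
    linarith [abs_nonneg (x - x')]
  -- This is the parameter at which the two lines meet; it lies inside the strip once the Lipschitz
  -- bound fails.
  have ht : |-(x - x') / (k - k')| < 1 / 2 := by
    rw [abs_div, abs_neg, div_lt_iff₀ (abs_pos.2 hne)]
    linarith
  have heq : chordPoint x k (-(x - x') / (k - k')) = chordPoint x' k' (-(x - x') / (k - k')) :=
    plane_ext (by simp only [chordPoint_zero]; field_simp; ring) (by simp)
  have h1 := hrul x hx k hk.symm _ ht
  have h2 := hrul x' hx' k' hk'.symm _ ht
  rw [heq, h2] at h1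
  exact hne (by rw [h1, sub_self])

/-- A Lipschitz extension of the slopes of the rulings gives straight chords, through the rulings
and the flat pieces between them. -/
theorem IsFlatSurface.sff_chord_eq_zero {l : ℝ} (hl : 0 < l)
    (hX : ∀ p ∈ OpenStrip, X (glide l p) = X p) {κ : ℝ → ℝ} (hκ : LipschitzWith 2 κ)
    (hκW : ∀ x, sff X e₀ e₀ (chordPoint x 0 0) ≠ 0 →
      κ x = kernelSlope X (chordPoint x 0 0)) (x : ℝ) {t : ℝ} (ht : |t| < 1 / 2) :
    sff X (chordDir (κ x)) (chordDir (κ x)) (chordPoint x (κ x) t) = 0 := by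
  set p := chordPoint x (κ x) t with hp
  have hpS : p ∈ OpenStrip := chordPoint_mem_openStrip ht
  by_cases hne : sff X e₀ e₀ p = 0
  · obtain ⟨h1, h2⟩ := h.sff_e₁_eq_zero hl hX hpS hne
    rw [(h.sff_chordDir hpS _).2, (h.sff_chordDir hpS _).1, hne, h1, h2]
    ring
  set k := kernelSlope X p with hk
  have hw : p + (-t) • chordDir k = chordPoint (x + t * κ x - t * k) 0 0 :=
    plane_ext (by simp [hp]; ring) (by simp [hp])
  obtain ⟨h1, h2⟩ := h.kernelSlope_along_ruling (T := -t) convex_openStrip hpS hne hk.symm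
    (by rw [hw]; exact chordPoint_mem_openStrip (by norm_num))
  rw [hw] at h1 h2
  have h3 := hκW _ h1
  rw [h2] at h3
  -- The ruling through p crosses the midline where κ = k, so |κ x - k| ≤ 2|t||κ x - k| with 2|t| <
  -- 1. The chord is therefore that ruling.
  have h4 := hκ.dist_le_mul x (x + t * κ x - t * k)
  rw [h3, Real.dist_eq, Real.dist_eq, show x - (x + t * κ x - t * k) = t * (k - κ x) by ring,
    abs_mul, abs_sub_comm k] at h4
  have h5 : |κ x - k| = 0 := by
    push_cast at h4
    nlinarith [abs_nonneg (κ x - k), abs_nonneg t]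
  rw [show κ x = k by linarith [abs_eq_zero.1 h5]]
  exact h.sff_chordDir_kernelSlope hpS hne

end Chords

/-- A paper Moebius band has a continuous family of straight chords which do not cross. -/
theorem IsSmoothPaperMoebius.exists_chords (h : IsSmoothPaperMoebius hl I) :
    ∃ (κ : ℝ → ℝ) (a : ℝ), LipschitzWith 2 κ ∧ κ (a + l) = -κ a ∧
      ∀ x, ∃ d : Space, ‖d‖ ^ 2 = 1 + κ x ^ 2 ∧ ∀ t : ℝ, |t| ≤ 1 / 2 →
        unroll hl I (chordPoint x (κ x) t) = unroll hl I (chordPoint x (κ x) 0) + t • d := by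
  set X := unroll hl I with hXdef
  have hF : IsFlatSurface X OpenStrip := h.isFlatSurface
  have hX : ∀ p ∈ OpenStrip, X (glide l p) = X p := fun p hp => unroll_glide (openStrip_subset hp)
  obtain ⟨κ, a, hκ, hκa, hκW⟩ : ∃ (κ : ℝ → ℝ) (a : ℝ), LipschitzWith 2 κ ∧ κ (a + l) = -κ a ∧
      ∀ x, sff X e₀ e₀ (chordPoint x 0 0) ≠ 0 → κ x = kernelSlope X (chordPoint x 0 0) := by
    obtain ⟨κ, hκ, hκW⟩ := LipschitzOnWith.extend_real (K := 2)
      (f := fun x => kernelSlope X (chordPoint x 0 0))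
      (s := {x | sff X e₀ e₀ (chordPoint x 0 0) ≠ 0})
      (LipschitzOnWith.of_dist_le_mul fun x hx y hy => hF.abs_kernelSlope_sub_le hx hy)
    by_cases hW : ∃ a, sff X e₀ e₀ (chordPoint a 0 0) ≠ 0
    · obtain ⟨a, ha⟩ := hW
      have hg : chordPoint (a + l) 0 0 = glide l (chordPoint a 0 0) :=
        plane_ext (by simp) (by simp; norm_num)
      obtain ⟨h1, h2⟩ := kernelSlope_glide hF hX
        (chordPoint_mem_openStrip (x := a) (k := 0) (t := 0) (by norm_num))
      rw [← hg] at h1 h2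
      refine ⟨κ, a, hκ, ?_, fun x hx => (hκW hx).symm⟩
      rw [← hκW ha, ← hκW (show a + l ∈ {x | sff X e₀ e₀ (chordPoint x 0 0) ≠ 0} by
        change _ ≠ _
        rw [h1]
        exact neg_ne_zero.2 ha)]
      exact h2
    -- With no ruling through the midline there is no constraint on κ, and vertical chords serve;
    -- this case need not be excluded.
    · push Not at hW
      exact ⟨fun _ => 0, 0, LipschitzWith.const' 0, by simp, fun x hx => absurd (hW x) hx⟩
  refine ⟨κ, a, hκ, hκa, fun x => ⟨dir (chordDir (κ x)) X (chordPoint x (κ x) 0), ?_, ?_⟩⟩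
  · rw [hF.norm_dir _ (chordPoint_mem_openStrip (by norm_num)), norm_chordDir_sq]
  have hopen : ∀ t ∈ Set.Ioo (-(1 / 2) : ℝ) (1 / 2), X (chordPoint x (κ x) t) =
      X (chordPoint x (κ x) 0) + t • dir (chordDir (κ x)) X (chordPoint x (κ x) 0) := by
    intro t ht
    have := hF.eq_add_smul_of_sff_eq_zero (p := chordPoint x (κ x) 0) (v := chordDir (κ x))
      (T := t) fun s hs => by
        have hs' : |s| < 1 / 2 := by
          have := Set.abs_sub_left_of_mem_uIcc hs
          rw [sub_zero, sub_zero] at this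
          exact this.trans_lt (abs_lt.2 ht)
        rw [chordPoint_add_smul, zero_add]
        exact ⟨chordPoint_mem_openStrip hs', hF.sff_chord_eq_zero hl hX hκ hκW x hs'⟩
    rwa [chordPoint_add_smul, zero_add] at this
  -- The endpoints lie on the boundary, where straightness follows by continuity alone.
  have hclosed := Set.EqOn.of_subset_closure (t := Set.Icc (-(1 / 2) : ℝ) (1 / 2)) hopen
    (h.isometric.continuousOn_unroll.comp (s := Set.Icc (-(1 / 2) : ℝ) (1 / 2))
      (Continuous.continuousOn (f := fun t => chordPoint x (κ x) t) (by
        unfold chordPoint; fun_prop)) fun t ht => chordPoint_mem_strip (abs_le.2 ht))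
    (by fun_prop) Set.Ioo_subset_Icc_self (by rw [closure_Ioo (by norm_num)])
  exact fun t ht => hclosed (abs_le.1 ht)

/-! ### Continuous logarithms and the perpendicular pair. -/

theorem exists_continuous_exp_eq {F : ℝ × ℝ → ℂ} (hF : Continuous F) (h0 : ∀ x, F x ≠ 0) :
    ∃ G : ℝ × ℝ → ℂ, Continuous G ∧ ∀ x, Complex.exp (G x) = F x := by
  obtain ⟨G, ⟨-, hG⟩, -⟩ := Complex.isCoveringMapOn_exp.existsUnique_continuousMap_lifts
    (⟨F, hF⟩ : C(ℝ × ℝ, ℂ)) (a₀ := 0) (Complex.exp_log (h0 0)) h0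
  exact ⟨G, G.continuous, fun x => congrFun hG x⟩

theorem eqOn_of_exp_eqOn {s : Set ℝ} (hs : IsPreconnected s) {f g : ℝ → ℂ}
    (hf : ContinuousOn f s) (hg : ContinuousOn g s)
    (h : ∀ t ∈ s, Complex.exp (f t) = Complex.exp (g t)) {a : ℝ} (ha : a ∈ s) (hfg : f a = g a) :
    Set.EqOn f g s :=
  Complex.isCoveringMap_exp.eqOn_of_comp_eqOn hs hf hg (fun t ht => Subtype.ext (h t ht)) ha hfg

/-- A Borsuk-Ulam type statement for the triangle `a ≤ s ≤ t ≤ b`. -/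
theorem exists_eq_zero_of_triangle {F : ℝ × ℝ → ℂ} (hF : Continuous F) {a b : ℝ} (hab : a ≤ b)
    (hdiag : ∀ s ∈ Set.Icc a b, F (s, s) ∈ Complex.slitPlane) (hends : F (a, a) = F (b, b))
    (hanti : ∀ t ∈ Set.Icc a b, F (t, b) = -F (a, t)) :
    ∃ s t, a ≤ s ∧ s ≤ t ∧ t ≤ b ∧ F (s, t) = 0 := by
  by_contra! hne
  -- A retraction of the plane onto the triangle, so that the logarithm can be taken on a simply
  -- connected space.
  let r : ℝ × ℝ → ℝ × ℝ := fun x =>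
    (max a (min x.1 (max a (min x.2 b))), max a (min x.2 b))
  have hr : Continuous r := by fun_prop
  obtain ⟨G, hG, hGF⟩ := exists_continuous_exp_eq (hF.comp hr) fun x =>
    hne _ _ (le_max_left _ _) (max_le (le_max_left _ _) (min_le_right _ _))
      (max_le hab (min_le_right _ _))
  have hGF' : ∀ s t, a ≤ s → s ≤ t → t ≤ b → Complex.exp (G (s, t)) = F (s, t) := by
    intro s t h1 h2 h3
    rw [hGF]
    simp only [Function.comp, r, min_eq_left h3, max_eq_right (h1.trans h2), min_eq_left h2,
      max_eq_right h1]
  have haI : a ∈ Set.Icc a b := Set.left_mem_Icc.2 hab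
  have hbI : b ∈ Set.Icc a b := Set.right_mem_Icc.2 hab
  -- The sign change makes G(t, b) - G(a, t) constant, so G gains the same amount on each leg of the
  -- triangle.
  have h1 : Set.EqOn (fun t => G (t, b) - G (a, t)) (fun _ => G (a, b) - G (a, a))
      (Set.Icc a b) := by
    have hexp : ∀ t ∈ Set.Icc a b, Complex.exp (G (t, b) - G (a, t)) = -1 := fun t ht => by
      rw [Complex.exp_sub, hGF' _ _ ht.1 ht.2 le_rfl, hGF' _ _ le_rfl ht.1 ht.2, hanti t ht,
        neg_div, div_self (hne _ _ le_rfl ht.1 ht.2)]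
    refine eqOn_of_exp_eqOn isPreconnected_Icc (by fun_prop) (by fun_prop) (fun t ht => ?_) haI rfl
    rw [hexp t ht, hexp a haI]
  -- On the diagonal G differs from the principal logarithm by a constant, hence G(a, a) = G(b, b).
  -- The gain on each leg is then zero, contradicting F(a, b) = -F(a, a) ≠ 0.
  have h2 : Set.EqOn (fun t => G (t, t))
      (fun t => Complex.log (F (t, t)) + (G (a, a) - Complex.log (F (a, a)))) (Set.Icc a b) := by
    refine eqOn_of_exp_eqOn isPreconnected_Icc (by fun_prop) ?_ (fun t ht => ?_) haI (by simp)
    · exact (ContinuousOn.clog (by fun_prop) hdiag).add continuousOn_const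
    · rw [Complex.exp_add, Complex.exp_sub, hGF' _ _ ht.1 le_rfl ht.2, hGF' _ _ le_rfl le_rfl hab,
        Complex.exp_log (Complex.slitPlane_ne_zero (hdiag t ht)),
        Complex.exp_log (Complex.slitPlane_ne_zero (hdiag a haI)),
        div_self (Complex.slitPlane_ne_zero (hdiag a haI)), mul_one]
  have h3 := h1 hbI
  have h4 := h2 hbI
  simp only at h3 h4
  rw [← hends] at h4
  have h5 : G (a, b) = G (a, a) := by linear_combination (h4 - h3) / 2
  have h6 := hGF' _ _ le_rfl hab le_rfl
  have h7 := hanti a haI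
  rw [h5, hGF' _ _ le_rfl le_rfl hab] at h6
  rw [← h6] at h7
  exact Complex.slitPlane_ne_zero (hdiag a haI) (by linear_combination h7 / 2)

/-- In a continuous family of oriented lines that returns to its first line with the orientation
reversed, there are two lines which are coplanar and perpendicular. -/
theorem exists_perpendicular_coplanar {u m : ℝ → Space} (hu : Continuous u) (hm : Continuous m)
    {a b : ℝ} (hab : a ≤ b) (hu0 : ∀ s, u s ≠ 0) (hub : u b = -u a) (hmb : m b = m a) :
    ∃ s t, a ≤ s ∧ s ≤ t ∧ t ≤ b ∧ inner ℝ (u s) (u t) = 0 ∧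
      inner ℝ (m s - m t) (cross (u s) (u t)) = 0 := by
  have hcross : Continuous fun x : ℝ × ℝ => cross (u x.1) (u x.2) := by
    unfold cross
    fun_prop
  have hswap : ∀ x y z : Space, inner ℝ x (cross y (-z)) = inner ℝ x (cross z y) := by
    intro x y z
    simp only [inner_eq_sum, cross_apply_zero, cross_apply_one, cross_apply_two, PiLp.neg_apply]
    ring
  have hself : ∀ x y : Space, inner ℝ x (cross y y) = 0 := by
    intro x y
    simp only [inner_eq_sum, cross_apply_zero, cross_apply_one, cross_apply_two]
    ring
  obtain ⟨s, t, h1, h2, h3, h4⟩ := exists_eq_zero_of_triangle (a := a) (b := b)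
    (F := fun x => ((inner ℝ (u x.1) (u x.2) : ℝ) : ℂ) +
      ((inner ℝ (m x.1 - m x.2) (cross (u x.1) (u x.2)) : ℝ) : ℂ) * Complex.I)
    (by fun_prop) hab
    (fun s _ => by
      left
      have := hu0 s
      rw [real_inner_self_eq_norm_sq, sub_self, inner_zero_left, Complex.ofReal_zero, zero_mul,
        add_zero, Complex.ofReal_re]
      positivity)
    (by simp [hub, hmb])
    (fun t _ => by
      simp only [hub, hmb, hswap, inner_neg_right]
      rw [← neg_sub (m a), inner_neg_left, real_inner_comm]
      push_cast
      ring)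
  refine ⟨s, t, h1, h2, h3, ?_, ?_⟩
  · simpa using congrArg Complex.re h4
  · simpa using congrArg Complex.im h4

/-! ### Triangle inequalities in the common plane. -/

section Triangle

/-- Adding (l + k)² > 5 + k² and (l - k)² ≥ 1 + k² cancels the slope. -/
theorem sqrt_three_lt_of_le {l k A B : ℝ} (hA : A ≤ l + k) (hB : B ≤ l - k) (hA0 : 0 ≤ A)
    (hB0 : 0 ≤ B) (hA2 : 5 + k ^ 2 < A ^ 2) (hB2 : 1 + k ^ 2 ≤ B ^ 2) : Real.sqrt 3 < l := by
  by_contra! hle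
  set r := Real.sqrt 3
  have hr : r ^ 2 = 3 := Real.sq_sqrt (by norm_num)
  have h1 : A ^ 2 ≤ (r + k) ^ 2 := pow_le_pow_left₀ hA0 (by linarith) 2
  have h2 : B ^ 2 ≤ (r - k) ^ 2 := pow_le_pow_left₀ hB0 (by linarith) 2
  nlinarith

theorem dist_sq_of_orthogonal {u w o : Space} (huw : inner ℝ u w = 0) (x y : ℝ) :
    dist (o + x • u) (o + y • w) ^ 2 = x ^ 2 * ‖u‖ ^ 2 + y ^ 2 * ‖w‖ ^ 2 := by
  rw [dist_add_left, dist_eq_norm, norm_sub_sq_real, inner_smul_left, inner_smul_right, huw,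
    norm_smul, norm_smul, mul_pow, mul_pow, Real.norm_eq_abs, Real.norm_eq_abs, sq_abs, sq_abs]
  simp

/-- The two sides of a triangle of height at least one are long. -/
theorem lt_sq_dist_add_dist {u w o : Space} (huw : inner ℝ u w = 0) {x β : ℝ}
    (hx : 1 ≤ x ^ 2 * ‖u‖ ^ 2) (hxβ : 1 < x ^ 2 * ‖u‖ ^ 2 ∨ β ≠ 0) (hw : w ≠ 0) :
    4 + ‖w‖ ^ 2 < (dist (o + x • u) (o + (-(1 / 2) - β) • w) +
      dist (o + x • u) (o + (1 / 2 - β) • w)) ^ 2 := by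
  have hp := dist_sq_of_orthogonal (o := o) huw x (-(1 / 2) - β)
  have hq := dist_sq_of_orthogonal (o := o) huw x (1 / 2 - β)
  set p := dist (o + x • u) (o + (-(1 / 2) - β) • w)
  set q := dist (o + x • u) (o + (1 / 2 - β) • w)
  set H := x ^ 2 * ‖u‖ ^ 2
  set W := ‖w‖ ^ 2
  have hW : 0 < W := by positivity
  have hp0 : 0 ≤ p := dist_nonneg
  have hq0 : 0 ≤ q := dist_nonneg
  -- Since p² + q² = 2H + (1/2 + 2β²)W, this bound on pq gives (p + q)² ≥ 4H + W, strictly unless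
  -- the triangle is isosceles (β = 0).
  have hid : (H + (1 / 4 - β ^ 2) * W) ^ 2 + 4 * β ^ 2 * H * W = (p * q) ^ 2 := by
    rw [mul_pow, hp, hq]; ring
  rcases hxβ with hH | hβ
  · have h1 : (H + (1 / 4 - β ^ 2) * W) ^ 2 ≤ (p * q) ^ 2 := by
      rw [← hid]
      have : 0 ≤ 4 * β ^ 2 * H * W := by positivity
      linarith
    have h2 := (le_abs_self _).trans (abs_le_of_sq_le_sq h1 (by positivity))
    linarith [add_sq p q]
  · have h1 : (H + (1 / 4 - β ^ 2) * W) ^ 2 < (p * q) ^ 2 := by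
      rw [← hid]
      have : 0 < 4 * β ^ 2 * H * W := by positivity
      linarith
    have h2 := (le_abs_self _).trans_lt (abs_lt_of_sq_lt_sq h1 (by positivity))
    linarith [add_sq p q]

/-- The inequality between the four arcs of the boundary cut out by two perpendicular chords
in a plane: the triangle spanned by the second chord and the far end of the first one is large. -/
theorem sqrt_three_lt_of_dist_le {u w o : Space} (huw : inner ℝ u w = 0) {α β k l : ℝ}
    (hu : 1 ≤ ‖u‖ ^ 2) (hw : ‖w‖ ^ 2 = 1 + k ^ 2) (hα : 1 / 2 ≤ |α|)
    (hαβ : 1 / 2 < |α| ∨ β ≠ 0) {P₁ P₂ Q₁ Q₂ : Space}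
    (hP₁ : P₁ = o + (-(1 / 2) - α) • u) (hP₂ : P₂ = o + (1 / 2 - α) • u)
    (hQ₁ : Q₁ = o + (-(1 / 2) - β) • w) (hQ₂ : Q₂ = o + (1 / 2 - β) • w)
    (h₁ : dist P₁ Q₁ + dist P₁ Q₂ ≤ l - k) (h₂ : dist P₂ Q₁ + dist P₂ Q₂ ≤ l + k) :
    Real.sqrt 3 < l := by
  have hw0 : w ≠ 0 := by
    rintro rfl
    rw [norm_zero] at hw
    nlinarith [sq_nonneg k]
  have hbase : dist Q₁ Q₂ ^ 2 = 1 + k ^ 2 := by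
    rw [hQ₁, hQ₂, dist_add_left, dist_eq_norm, ← sub_smul, norm_smul, mul_pow, hw]
    norm_num
  have hnear : ∀ P : Space, 1 + k ^ 2 ≤ (dist P Q₁ + dist P Q₂) ^ 2 := fun P => by
    rw [← hbase]
    gcongr
    rw [dist_comm P Q₁]
    exact dist_triangle _ _ _
  -- The end of the chord farther from o has parameter of size |α| + 1/2 ≥ 1, so its height over the
  -- other line is at least 1.
  have hfar : ∀ x : ℝ, |α| + 1 / 2 ≤ |x| →
      5 + k ^ 2 < (dist (o + x • u) Q₁ + dist (o + x • u) Q₂) ^ 2 := by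
    intro x hx
    have hx1 : (|α| + 1 / 2) ^ 2 ≤ x ^ 2 := by
      rw [← sq_abs x]
      gcongr
    have hx2 : (|α| + 1 / 2) ^ 2 ≤ x ^ 2 * ‖u‖ ^ 2 :=
      hx1.trans (le_mul_of_one_le_right (sq_nonneg _) hu)
    have := lt_sq_dist_add_dist (o := o) huw (x := x) (β := β) (by nlinarith)
      (hαβ.imp_left fun h => by nlinarith) hw0
    rw [hQ₁, hQ₂]
    linarith
  rcases le_total 0 α with h0 | h0
  · have := hfar (-(1 / 2) - α) (by
      rw [abs_of_nonneg h0, abs_of_nonpos (by linarith)]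
      linarith)
    rw [← hP₁] at this
    exact sqrt_three_lt_of_le (k := -k) (h₁.trans_eq (sub_eq_add_neg l k))
      (h₂.trans_eq (sub_neg_eq_add l k).symm) (by positivity) (by positivity) (by rwa [neg_sq]) (by rw [neg_sq]; exact hnear P₂)
  · have := hfar (1 / 2 - α) (by
      rw [abs_of_nonpos h0, abs_of_nonneg (by linarith)]
      linarith)
    rw [← hP₂] at this
    exact sqrt_three_lt_of_le h₂ h₁ (by positivity) (by positivity) this (hnear P₁)

/-- Two coplanar perpendicular lines meet. -/
theorem exists_add_smul_eq_add_smul {u w m n : Space} (hu : u ≠ 0) (hw : w ≠ 0)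
    (huw : inner ℝ u w = 0) (h : inner ℝ (m - n) (cross u w) = 0) :
    ∃ α β : ℝ, m + α • u = n + β • w := by
  have huu : (inner ℝ u u : ℝ) ≠ 0 := inner_self_ne_zero.2 hu
  have hww : (inner ℝ w w : ℝ) ≠ 0 := inner_self_ne_zero.2 hw
  have hwu : (inner ℝ w u : ℝ) = 0 := by rw [real_inner_comm, huw]
  set c : ℝ := inner ℝ (m - n) u / inner ℝ u u
  set d : ℝ := inner ℝ (m - n) w / inner ℝ w w
  -- The part of m - n left after projecting to u and w is orthogonal to u, w and u × w, hence zero.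
  have h1 : inner ℝ (m - n - c • u - d • w) u = 0 := by
    simp only [inner_sub_left _ (_ • _), inner_smul_left, RCLike.conj_to_real, hwu, mul_zero,
      c, div_mul_cancel₀ _ huu, sub_self]
  have h2 : inner ℝ (m - n - c • u - d • w) w = 0 := by
    simp only [inner_sub_left _ (_ • _), inner_smul_left, RCLike.conj_to_real, huw, mul_zero,
      sub_zero, d, div_mul_cancel₀ _ hww, sub_self]
  have h3 : inner ℝ (m - n - c • u - d • w) (cross u w) = 0 := by
    simp only [inner_sub_left _ (_ • _), inner_smul_left, h, inner_cross_left,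
      inner_cross_right, mul_zero, sub_zero]
  have h4 := smul_cross_eq h1 h2
  rw [h3, zero_smul, inner_cross_self, huw, zero_pow two_ne_zero, sub_zero, smul_eq_zero] at h4
  have h5 := h4.resolve_left (mul_ne_zero huu hww)
  refine ⟨-c, d, ?_⟩
  rw [neg_smul, ← sub_eq_zero, ← h5]
  abel

end Triangle

/-! ### Embeddedness and boundary arcs. -/

theorem chordPoint_glide (x k t : ℝ) :
    chordPoint (x + l) (-k) t = glide l (chordPoint x k (-t)) :=
  plane_ext (by simp; ring) (by simp; ring)

/-- Two chords of an embedded band that do not cross in the strip can only have images that meet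
at endpoints. -/
theorem abs_eq_half_of_unroll_chordPoint_eq (hI : Function.Injective I) {s t k k' α β : ℝ}
    (hst : s < t) (htl : t - s < l) (h₁ : |k - k'| ≤ 2 * (t - s))
    (h₂ : |k + k'| ≤ 2 * (l - (t - s))) (hα : |α| ≤ 1 / 2) (hβ : |β| ≤ 1 / 2)
    (h : unroll hl I (chordPoint s k α) = unroll hl I (chordPoint t k' β)) :
    |α| = 1 / 2 ∧ |β| = 1 / 2 := by
  obtain ⟨n, h0, h1⟩ := exists_int_of_unroll_eq hI (chordPoint_mem_strip hα)
    (chordPoint_mem_strip hβ) h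
  simp only [chordPoint_zero, chordPoint_one] at h0 h1
  have hαβ : |α| = |β| := by
    split_ifs at h1
    · rw [show β = α by linarith]
    · rw [show β = -α by linarith, abs_neg]
  suffices |α| = 1 / 2 from ⟨this, hαβ ▸ this⟩
  by_contra hne
  have hlt : |α| < 1 / 2 := lt_of_le_of_ne hα hne
  split_ifs at h1 with hn
  · rw [show β = α by linarith] at h0
    have hb : |α * (k - k')| < t - s := by
      rw [abs_mul]
      nlinarith [abs_nonneg α, abs_nonneg (k - k')]
    rw [show α * (k - k') = t - s - n * l by linarith, abs_lt] at hb
    rcases lt_trichotomy n 0 with hn0 | rfl | hn0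
    · have : (n : ℝ) ≤ -1 := by exact_mod_cast Int.le_sub_one_of_lt hn0
      nlinarith
    · simp at hb
    -- Parity matters: n = 1 would not contradict the bound, but an even positive n is at least 2.
    · have h2 : 2 ≤ n := by
        obtain ⟨j, rfl⟩ := hn
        omega
      have : (2 : ℝ) ≤ n := by exact_mod_cast h2
      nlinarith
  · rw [show β = -α by linarith] at h0
    have hb : |α * (k + k')| < l - (t - s) := by
      rw [abs_mul]
      nlinarith [abs_nonneg α, abs_nonneg (k + k')]
    rw [show α * (k + k') = t - s - n * l by linarith, abs_lt] at hb
    rcases lt_trichotomy n 0 with hn0 | rfl | hn0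
    · have : (n : ℝ) ≤ -1 := by exact_mod_cast Int.le_sub_one_of_lt hn0
      nlinarith
    · simp at hn
    · have : (1 : ℝ) ≤ n := by exact_mod_cast hn0
      nlinarith

theorem dist_of_apply_one_eq {p q : Plane} (h : p 1 = q 1) : dist p q = |p 0 - q 0| := by
  rw [EuclideanSpace.dist_eq, Fin.sum_univ_two, h, dist_self, Real.dist_eq, sq_abs,
    zero_pow two_ne_zero, add_zero, Real.sqrt_sq_eq_abs]

/-- Used at τ = ±1/2, where the horizontal segment is a boundary arc between chord ends. -/
theorem PreservesArcLength.dist_unroll_chordPoint_le (h : PreservesArcLength hl I)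
    {s t k k' τ : ℝ} (hτ : |τ| ≤ 1 / 2) :
    dist (unroll hl I (chordPoint s k τ)) (unroll hl I (chordPoint t k' τ)) ≤
      |t - s + τ * (k' - k)| := by
  refine (h.dist_unroll_le (chordPoint_mem_strip hτ) (chordPoint_mem_strip hτ)).trans_eq ?_
  rw [dist_comm, dist_of_apply_one_eq (by simp)]
  simp only [chordPoint_zero]
  congr 1
  ring

/-- The arc the other way around the band: the glide moves the first point one period ahead, to
height parameter τ. -/
theorem PreservesArcLength.dist_unroll_chordPoint_neg_le (h : PreservesArcLength hl I)
    {s t k k' τ : ℝ} (hτ : |τ| ≤ 1 / 2) :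
    dist (unroll hl I (chordPoint s k (-τ))) (unroll hl I (chordPoint t k' τ)) ≤
      |l - (t - s) - τ * (k + k')| := by
  rw [← unroll_glide (chordPoint_mem_strip (by rwa [abs_neg])), ← chordPoint_glide]
  refine (h.dist_unroll_chordPoint_le hτ).trans_eq ?_
  rw [← abs_neg]
  congr 1
  ring

end PaperMoebius

/-! ### Assembly. -/

theorem mainTheorem1 (l : ℝ) (hl : 0 < l) (I : PaperMoebius.FlatMoebius l → PaperMoebius.Space)
    (hI : PaperMoebius.IsSmoothEmbeddedPaperMoebius hl I) : Real.sqrt 3 < l := by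
  open PaperMoebius in
  obtain ⟨κ, a, hκ, hκa, hd⟩ := hI.toIsSmoothPaperMoebius.exists_chords
  choose d hdn hd using hd
  have hiso := hI.isometric
  have hhalf : |(1 / 2 : ℝ)| ≤ 1 / 2 := by rw [abs_of_pos (by norm_num)]
  have hhalf' : |-(1 / 2 : ℝ)| ≤ 1 / 2 := by rwa [abs_neg]
  have hzero : |(0 : ℝ)| ≤ 1 / 2 := by norm_num
  have hmc : ∀ τ : ℝ, |τ| ≤ 1 / 2 →
      Continuous fun x => unroll hl I (chordPoint x (κ x) τ) := fun τ hτ => by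
    refine hiso.continuousOn_unroll.comp_continuous ?_ fun x => chordPoint_mem_strip hτ
    have := hκ.continuous
    unfold chordPoint
    fun_prop
  have hdc : Continuous d := by
    have : d = fun x => (2 : ℝ) • (unroll hl I (chordPoint x (κ x) (1 / 2)) -
        unroll hl I (chordPoint x (κ x) 0)) := by
      funext x
      rw [hd x _ hhalf, add_sub_cancel_left, smul_smul]
      norm_num
    rw [this]
    exact ((hmc _ hhalf).sub (hmc _ hzero)).const_smul (2 : ℝ)
  have hd0 : ∀ x, d x ≠ 0 := fun x h0 => by
    have := hdn x
    rw [h0, norm_zero] at this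
    nlinarith [sq_nonneg (κ x)]
  have hglide : ∀ τ : ℝ, |τ| ≤ 1 / 2 → unroll hl I (chordPoint (a + l) (κ (a + l)) τ) =
      unroll hl I (chordPoint a (κ a) (-τ)) := fun τ hτ => by
    rw [hκa, chordPoint_glide, unroll_glide (chordPoint_mem_strip (by rwa [abs_neg]))]
  have hm : unroll hl I (chordPoint (a + l) (κ (a + l)) 0) =
      unroll hl I (chordPoint a (κ a) 0) := by
    rw [hglide 0 hzero, neg_zero]
  have hda : d (a + l) = -d a := by
    have h1 := hglide _ hhalf
    rw [hd _ _ hhalf, hd _ _ hhalf', hm, add_right_inj, neg_smul, ← smul_neg] at h1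
    exact smul_right_injective Space (by norm_num : (1 / 2 : ℝ) ≠ 0) h1
  obtain ⟨s, t, has, hst, hta, hperp, hcop⟩ := exists_perpendicular_coplanar hdc (hmc 0 hzero)
    (by linarith : a ≤ a + l) hd0 hda hm
  have hne : s ≠ t := fun h => by
    rw [h] at hperp
    exact hd0 t (inner_self_eq_zero.1 hperp)
  have hst' : s < t := lt_of_le_of_ne hst hne
  have htl : t - s < l := by
    refine lt_of_le_of_ne (by linarith) fun h => ?_
    have hs : s = a := by linarith
    have ht : t = a + l := by linarith
    rw [hs, ht, hda, inner_neg_right, neg_eq_zero] at hperp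
    exact hd0 a (inner_self_eq_zero.1 hperp)
  have hL : ∀ x y, x ≤ y → |κ x - κ y| ≤ 2 * (y - x) := fun x y hxy => by
    have := hκ.dist_le_mul x y
    rwa [Real.dist_eq, Real.dist_eq, abs_sub_comm x y, abs_of_nonneg (sub_nonneg.2 hxy)] at this
  have hk₁ := hL s t hst
  -- Noncrossing around the seam: compare κ on [a, s] and on [t, a + l], using κ(a + l) = -κ(a).
  have hk₂ : |κ s + κ t| ≤ 2 * (l - (t - s)) := by
    have h1 := hL a s has
    have h2 := hL t (a + l) hta
    rw [hκa] at h2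
    calc |κ s + κ t| = |(κ t - -κ a) - (κ a - κ s)| := by congr 1; ring
      _ ≤ |κ t - -κ a| + |κ a - κ s| := abs_sub _ _
      _ ≤ 2 * (l - (t - s)) := by linarith
  obtain ⟨α, β, ho⟩ := exists_add_smul_eq_add_smul (hd0 s) (hd0 t) hperp hcop
  have hend : |α| ≤ 1 / 2 → |β| ≤ 1 / 2 → |α| = 1 / 2 ∧ |β| = 1 / 2 := fun hα hβ =>
    abs_eq_half_of_unroll_chordPoint_eq hI.injective hst' htl hk₁ hk₂ hα hβ (by
      rw [hd s α hα, hd t β hβ, ho])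
  set o := unroll hl I (chordPoint s (κ s) 0) + α • d s with hodef
  have hP : ∀ τ : ℝ, |τ| ≤ 1 / 2 →
      unroll hl I (chordPoint s (κ s) τ) = o + (τ - α) • d s := fun τ hτ => by
    rw [hd s τ hτ, hodef, sub_smul]
    abel
  have hQ : ∀ τ : ℝ, |τ| ≤ 1 / 2 →
      unroll hl I (chordPoint t (κ t) τ) = o + (τ - β) • d t := fun τ hτ => by
    rw [hd t τ hτ, ho, sub_smul]
    abel
  have hk₁' := abs_le.1 hk₁
  have hk₂' := abs_le.1 hk₂
  have d₁₁ := hiso.dist_unroll_chordPoint_le (s := s) (t := t) (k := κ s) (k' := κ t) hhalf'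
  have d₂₂ := hiso.dist_unroll_chordPoint_le (s := s) (t := t) (k := κ s) (k' := κ t) hhalf
  have d₁₂ := hiso.dist_unroll_chordPoint_neg_le (s := s) (t := t) (k := κ s) (k' := κ t) hhalf
  have d₂₁ := hiso.dist_unroll_chordPoint_neg_le (s := s) (t := t) (k := κ s) (k' := κ t) hhalf'
  rw [neg_neg] at d₂₁
  rw [abs_of_nonneg (by linarith)] at d₁₁ d₁₂ d₂₁ d₂₂
  have hone : ∀ x, 1 ≤ ‖d x‖ ^ 2 := fun x => by
    rw [hdn]
    linarith [sq_nonneg (κ x)]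
  -- If o lies on both chords it is an endpoint of each, so β ≠ 0 and the first case applies.
  -- Otherwise o is off one of the chords, and the two chords exchange roles if it is off the second
  -- only.
  by_cases hα : 1 / 2 ≤ |α| ∧ (1 / 2 < |α| ∨ β ≠ 0)
  · exact sqrt_three_lt_of_dist_le hperp (hone s) (hdn t) hα.1 hα.2 (hP _ hhalf') (hP _ hhalf)
      (hQ _ hhalf') (hQ _ hhalf) (by linarith) (by linarith)
  · have hα' : |α| ≤ 1 / 2 := by
      by_contra! hlt
      exact hα ⟨hlt.le, Or.inl hlt⟩
    have hβ : 1 / 2 < |β| := by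
      by_contra! hle
      obtain ⟨h1, h2⟩ := hend hα' hle
      refine hα ⟨h1.ge, Or.inr ?_⟩
      rintro rfl
      norm_num at h2
    refine sqrt_three_lt_of_dist_le (k := -κ s) (by rw [real_inner_comm]; exact hperp) (hone t)
      (by rw [hdn, neg_sq]) hβ.le (Or.inl hβ) (hQ _ hhalf') (hQ _ hhalf) (hP _ hhalf')
      (hP _ hhalf) ?_ ?_
    all_goals
      rw [dist_comm, dist_comm (unroll hl I (chordPoint t _ _))]
      linarith
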